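/- Let $d\in\mathbb N$ and $1\le n\le d-1$. Let $T:\mathbb{R}^d\to[0,\infty)$ be measurable, let $T(p)$, $p=-i\nabla$, be the operator on $L^2(\mathbb{R}^d)$ that acts as multiplication by $T(\eta)$ in Fourier space, and let $\mathcal Q(T(p))$ be its quadratic form domain. Let $V:\mathbb{R}^d\to\mathbb{R}$ be a measurable potential that is not almost everywhere zero and is relatively form compact with respect to $T(p)$, i.e. the operator $(T(p)+1)^{-1/2}\,|V|\,(T(p)+1)^{-1/2}$ (understood in the sense of quadratic forms) is compact on $L^2(\mathbb{R}^d)$. Let $T(p)+V$ be the self-adjoint operator associated with the sum of the quadratic forms of $T(p)$ and $V$ on $\mathcal Q(T(p))$. Suppose that there are a non-empty embedded $\mathcal C^2$ submanifold $\Sigma\subset\mathbb{R}^d$ of codimension $n$, an open set $\mathcal O\supset\Sigma$, and constants $C>0$ and $\gamma\ge n$ such that $$T(\eta)\le C\,\operatorname{dist}(\eta,\Sigma)^{\gamma}\qquad\text{for all }\eta\in\mathcal O .$$ (a) If $V\le 0$ almost everywhere, then $T(p)+V$ has infinitely many (distinct) strictly negative eigenvalues. (b) If $V\in L^1(\mathbb{R}^d)$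 and $\int_{\mathbb{R}^d}V\,dx\le 0$, then $T(p)+V$ has at least one strictly negative eigenvalue. -/

import Mathlib

open MeasureTheory FourierTransform
open scoped ComplexConjugate

noncomputable section

/-- Euclidean space `ℝ^d`. -/
abbrev Eucl (d : ℕ) : Type := EuclideanSpace ℝ (Fin d)

/-- The complex Hilbert space `L²(ℝ^d)`. -/
abbrev LTwo (d : ℕ) : Type := Lp ℂ 2 (volume : Measure (Eucl d))

/-- `Σ` is an (embedded) `C²` submanifold of `ℝ^d` of codimension `n`: around each of its points
there is a `C²` diffeomorphism `e` between open subsets of `ℝ^d` which carries the part of `Σ` in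
its source onto the part of its target where the first `n` coordinates vanish. -/
def IsC2Submanifold (d n : ℕ) (S : Set (Eucl d)) : Prop :=
  ∀ ω ∈ S, ∃ e : OpenPartialHomeomorph (Eucl d) (Eucl d),
    ω ∈ e.source ∧
    ContDiffOn ℝ 2 e e.source ∧
    ContDiffOn ℝ 2 e.symm e.target ∧
    ∀ x ∈ e.source, (x ∈ S ↔ ∀ i : Fin d, (i : ℕ) < n → e x i = 0)

/-- `u = m(p) f`, where `p = -i∇` and `m` is a real symbol, as a relation between `f` and `u` in
`L²(ℝ^d)`. Mathlib's Fourier transform `𝓕` is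
`𝓕 f ξ = ∫ exp (-2πi ⟪x, ξ⟫) f x dx`, so that the momentum `p` acts there as multiplication by
`2πξ`, and `m(p)` as multiplication by `m(2πξ)`. -/
def IsFourierMultiplier {d : ℕ} (m : Eucl d → ℝ) (f u : LTwo d) : Prop :=
  (𝓕 u : LTwo d) =ᵐ[volume]
    fun ξ => (m ((2 * Real.pi) • ξ) : ℂ) * (𝓕 f : LTwo d) ξ

/-- The potential `V` is relatively form compact with respect to `T(p)`:
`K = (T(p)+1)^{-1/2} |V| (T(p)+1)^{-1/2}` is a compact operator on `L²(ℝ^d)`. The product is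
understood in the sense of quadratic forms, i.e. `⟪f, K g⟫ = ∫ |V| (conj u) v` for
`u = (T(p)+1)^{-1/2} f` and `v = (T(p)+1)^{-1/2} g`. -/
def IsRelFormCompact {d : ℕ} (T V : Eucl d → ℝ) : Prop :=
  ∃ K : LTwo d →L[ℂ] LTwo d, IsCompactOperator K ∧
    ∀ f g u v : LTwo d,
      IsFourierMultiplier (fun η => (T η + 1) ^ (-(1 / 2) : ℝ)) f u →
      IsFourierMultiplier (fun η => (T η + 1) ^ (-(1 / 2) : ℝ)) g v →
      Integrable (fun x => ((|V x| : ℝ) : ℂ) * (conj (u x) * v x)) volume ∧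
      inner ℂ f (K g) = ∫ x, ((|V x| : ℝ) : ℂ) * (conj (u x) * v x)

/-- The quadratic form domain of `T(p)`: all `f ∈ L²` with `∫ T(2πξ) |𝓕 f ξ|² dξ < ∞`. -/
def formDomain {d : ℕ} (T : Eucl d → ℝ) : Set (LTwo d) :=
  {f | Integrable (fun ξ => T ((2 * Real.pi) • ξ) * ‖(𝓕 f : LTwo d) ξ‖ ^ 2) volume}

/-- The sesquilinear form `⟪g, (T(p) + V) f⟫` (used for `f` and `g` in the form domain of `T(p)`). -/
def energyForm {d : ℕ} (T V : Eucl d → ℝ) (g f : LTwo d) : ℂ :=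
  (∫ ξ, (T ((2 * Real.pi) • ξ) : ℂ) * (conj ((𝓕 g : LTwo d) ξ) * (𝓕 f : LTwo d) ξ)) +
    ∫ x, (V x : ℂ) * (conj (g x) * f x)

/-- The graph of the operator `T(p) + V` on `L²(ℝ^d)`, defined as the form sum: `f` belongs to its
domain and `(T(p) + V) f = h` when `f` is in the form domain of `T(p)` and
`⟪g, h⟫` is the value of the form at `(g, f)` for all `g` in the form domain. -/
def schrodingerGraph {d : ℕ} (T V : Eucl d → ℝ) : Set (LTwo d × LTwo d) :=
  {p | p.1 ∈ formDomain T ∧ ∀ g ∈ formDomain T, energyForm T V g p.1 = inner ℂ g p.2}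

/-- `E` is an eigenvalue of `T(p) + V`: there is `f ≠ 0` in the domain of this operator with
`(T(p) + V) f = E f`. -/
def IsSchrodingerEigenvalue {d : ℕ} (T V : Eucl d → ℝ) (E : ℝ) : Prop :=
  ∃ f : LTwo d, f ≠ 0 ∧ (f, (E : ℂ) • f) ∈ schrodingerGraph T V

end

/-! ### Variational theory of compact perturbations of coercive forms. -/

section FormPencil

open Filter Topology

variable {H : Type*} [NormedAddCommGroup H] [InnerProductSpace ℂ H]

/-! Write R = (T(p)+1)^{-1/2} and A = R². The form domain of T(p) is the range of R, and for f = Rφ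
the energy is ⟨φ, (1 - A + K)φ⟩ with a compact K representing V. Hence -e is an eigenvalue once M(e)
= 1 - A + eA + K (`formPencil`) has a kernel. For e > 0 this is a compact perturbation of a coercive
form, and at the supremum of those e for which M(e) takes a negative value a null vector appears. So
one vector of negative energy yields a negative eigenvalue (`exists_negative_eigenvalue`), and
negative subspaces of every finite dimension yield infinitely many (`IsFormPair.infinite_null`).

Negative energies come from the degeneracy of T. Since T vanishes to order γ ≥ n on a set of
codimension n, 1/T is not integrable near any point of Σ (`IsC2Submanifold.volume_sublevel_ge`,
`lintegral_inv_eq_top`). Functions whose Fourier transform is a normalised cut-off of 1/(T+δ) near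
such a point therefore have arbitrarily small kinetic energy, while they are bounded by 1 and
approach a plane wave locally uniformly (`exists_trial`).

For (a), Σ is infinite because n < d, and finitely many distinct plane waves are linearly
independent on every set of positive measure; where V is bounded away from zero, combinations of
trial functions thus gain more potential energy than they cost in kinetic energy
(`exists_negative_family`). For (b), the trial energies tend to ∫V ≤ 0. As this may be zero, a small
multiple of a function g coupled by V to the plane wave is added, which lowers the energy to first
order (`exists_negative_energy`). -/

theorem re_inner_add_smul_of_symmetric (M : H →L[ℂ] H) (hM : M.IsSymmetric) (x y : H) (c : ℂ) :
    (inner ℂ (x + c • y) (M (x + c • y))).re =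
      (inner ℂ x (M x)).re + 2 * (c * inner ℂ x (M y)).re + ‖c‖ ^ 2 * (inner ℂ y (M y)).re := by
  have h1 : inner ℂ y (M x) = conj (inner ℂ x (M y)) := by
    rw [inner_conj_symm]; exact (hM y x).symm
  simp only [map_add, map_smul, inner_add_left, inner_add_right, inner_smul_left,
    inner_smul_right, h1, Complex.add_re, Complex.add_im, ← Complex.normSq_eq_norm_sq, Complex.normSq_apply,
    Complex.mul_re, Complex.mul_im, Complex.conj_re, Complex.conj_im]
  ring

/-- First variation at a minimiser: moving from φ by -t z̄ x, with z = ⟨φ, Mx⟩, changes the form by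
-2t|z|² + t²|z|²s, where s is the form at x. This is at most -t|z|² once ts ≤ 1. -/
theorem inner_eq_zero_of_nonneg_on (M : H →L[ℂ] H) (hM : M.IsSymmetric) (X : Submodule ℂ H)
    (hpos : ∀ x ∈ X, 0 ≤ (inner ℂ x (M x)).re) {φ : H} (hφ : φ ∈ X)
    (h0 : (inner ℂ φ (M φ)).re = 0) {x : H} (hx : x ∈ X) : inner ℂ x (M φ) = 0 := by
  set z : ℂ := inner ℂ φ (M x) with hz
  have hzx : inner ℂ x (M φ) = conj z := by
    rw [hz, inner_conj_symm]; exact (hM x φ).symm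
  set s := (inner ℂ x (M x)).re with hs
  have hs0 : 0 ≤ s := hpos x hx
  set t : ℝ := 1 / (s + 1) with ht
  have ht0 : 0 < t := by positivity
  have hts : t * s ≤ 1 := by rw [ht, one_div, inv_mul_le_iff₀ (by positivity)]; linarith
  have key := hpos (φ + (-(t : ℂ) * conj z) • x) (X.add_mem hφ (X.smul_mem _ hx))
  rw [re_inner_add_smul_of_symmetric M hM, h0, ← hz, ← hs] at key
  have e1 : (-(t : ℂ) * conj z * z).re = -t * ‖z‖ ^ 2 := by
    rw [mul_assoc, mul_comm (conj z), Complex.mul_conj, Complex.normSq_eq_norm_sq]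
    norm_cast
  have e2 : ‖-(t : ℂ) * conj z‖ ^ 2 = t ^ 2 * ‖z‖ ^ 2 := by
    simp [mul_pow]
  rw [e1, e2] at key
  have hzz : ‖z‖ ^ 2 * t ≤ 0 := by
    nlinarith [mul_le_mul_of_nonneg_left hts (mul_nonneg ht0.le (sq_nonneg ‖z‖))]
  have : ‖z‖ ^ 2 ≤ 0 := by
    by_contra h
    push Not at h
    nlinarith [mul_pos h ht0]
  have hz0 : z = 0 := by
    rw [← norm_eq_zero]; exact pow_eq_zero_iff (two_ne_zero) |>.1 (le_antisymm this (sq_nonneg _))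
  rw [hzx, hz0, map_zero]

/-- A nonnegative form that is a compact perturbation of a coercive one attains the infimum `0`
on the unit sphere of a closed subspace. -/
theorem exists_unit_null_vector [CompleteSpace H] (D K : H →L[ℂ] H) (hD : D.IsSymmetric) (hK : K.IsSymmetric)
    (hKc : IsCompactOperator K) {δ : ℝ} (hδ : 0 < δ)
    (hDc : ∀ x, δ * ‖x‖ ^ 2 ≤ (inner ℂ x (D x)).re) (X : Submodule ℂ H)
    (hX : IsClosed (X : Set H)) (hpos : ∀ x ∈ X, 0 ≤ (inner ℂ x ((D + K) x)).re)
    (φ : ℕ → H) (hφX : ∀ k, φ k ∈ X) (hφ1 : ∀ k, ‖φ k‖ = 1)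
    (hφ : Tendsto (fun k => (inner ℂ (φ k) ((D + K) (φ k))).re) atTop (𝓝 0)) :
    ∃ ψ ∈ X, ‖ψ‖ = 1 ∧ ∀ x ∈ X, inner ℂ x ((D + K) ψ) = 0 := by
  have hM : (D + K).IsSymmetric := by
    intro x y
    have h1 := hD x y
    have h2 := hK x y
    simp only [ContinuousLinearMap.coe_coe] at h1 h2
    simp only [ContinuousLinearMap.coe_coe, add_apply, inner_add_left, h1, h2, inner_add_right]
  obtain ⟨y, -, σ, hσ, hy⟩ := (hKc.isCompact_closure_image_closedBall (f := (K : H →ₗ[ℂ] H)) 1).tendsto_subseq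
    (x := fun k => K (φ k)) (fun k => subset_closure ⟨φ k, by simp [hφ1], rfl⟩)
  set χ := fun k => φ (σ k) with hχ
  have hKχ : CauchySeq (fun k => K (χ k)) := hy.cauchySeq
  have hqχ : Tendsto (fun k => (inner ℂ (χ k) ((D + K) (χ k))).re) atTop (𝓝 0) :=
    hφ.comp hσ.tendsto_atTop
  -- Parallelogram law: the form at χ k + χ l is nonnegative, so the form at the difference is at
  -- most twice the sum of the two values. Coercivity of D and convergence of K (χ k) then make χ
  -- Cauchy in norm, so no weak limits are needed.
  have bound : ∀ k l, δ * ‖χ k - χ l‖ ^ 2 ≤ 2 * (inner ℂ (χ k) ((D + K) (χ k))).re +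
      2 * (inner ℂ (χ l) ((D + K) (χ l))).re + 2 * ‖K (χ k) - K (χ l)‖ := by
    intro k l
    have a1 := hpos (χ k + (1 : ℂ) • χ l) (X.add_mem (hφX _) (X.smul_mem _ (hφX _)))
    have a2 := re_inner_add_smul_of_symmetric (D + K) hM (χ k) (χ l) (-1)
    rw [re_inner_add_smul_of_symmetric (D + K) hM (χ k) (χ l) 1] at a1
    have a3 : χ k + (-1 : ℂ) • χ l = χ k - χ l := by simp [sub_eq_add_neg]
    rw [a3] at a2
    have a4 : (inner ℂ (χ k - χ l) ((D + K) (χ k - χ l))).re =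
        (inner ℂ (χ k - χ l) (D (χ k - χ l))).re + (inner ℂ (χ k - χ l) (K (χ k - χ l))).re := by
      simp
    have a5 : -(inner ℂ (χ k - χ l) (K (χ k - χ l))).re ≤ 2 * ‖K (χ k) - K (χ l)‖ := by
      calc _ ≤ |(inner ℂ (χ k - χ l) (K (χ k - χ l))).re| := neg_le_abs _
        _ ≤ ‖inner ℂ (χ k - χ l) (K (χ k - χ l))‖ := Complex.abs_re_le_norm _
        _ ≤ ‖χ k - χ l‖ * ‖K (χ k - χ l)‖ := norm_inner_le_norm _ _
        _ ≤ 2 * ‖K (χ k - χ l)‖ := by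
          gcongr
          calc _ ≤ ‖χ k‖ + ‖χ l‖ := norm_sub_le _ _
            _ = 2 := by simp only [hχ, hφ1]; norm_num
        _ = _ := by rw [map_sub]
    have a6 := hDc (χ k - χ l)
    simp only [one_mul, neg_mul, Complex.neg_re, norm_neg, norm_one, one_pow] at a1 a2
    linarith
  have hcau : CauchySeq χ := by
    rw [Metric.cauchySeq_iff]
    intro ε hε
    have hη : 0 < δ * ε ^ 2 / 8 := by positivity
    obtain ⟨N1, h1⟩ := Metric.cauchySeq_iff.1 hKχ _ hη
    obtain ⟨N2, h2⟩ := eventually_atTop.1 (hqχ.eventually (gt_mem_nhds hη))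
    refine ⟨max N1 N2, fun k hk l hl => ?_⟩
    have b := bound k l
    have b1 := h1 k (le_trans (le_max_left _ _) hk) l (le_trans (le_max_left _ _) hl)
    rw [dist_eq_norm] at b1
    have b2 := h2 k (le_trans (le_max_right _ _) hk)
    have b3 := h2 l (le_trans (le_max_right _ _) hl)
    rw [dist_eq_norm]
    have : δ * ‖χ k - χ l‖ ^ 2 < δ * ε ^ 2 := by linarith
    exact lt_of_pow_lt_pow_left₀ 2 hε.le (lt_of_mul_lt_mul_left this hδ.le)
  obtain ⟨ψ, hψ⟩ := cauchySeq_tendsto_of_complete hcau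
  have hψX : ψ ∈ X := hX.mem_of_tendsto hψ (Eventually.of_forall fun k => hφX _)
  have hψ1 : ‖ψ‖ = 1 := tendsto_nhds_unique hψ.norm (by simp [hχ, hφ1])
  have hψ0 : (inner ℂ ψ ((D + K) ψ)).re = 0 := by
    refine tendsto_nhds_unique ?_ hqχ
    have : Continuous fun x : H => (inner ℂ x ((D + K) x)).re := by fun_prop
    exact (this.tendsto ψ).comp hψ
  exact ⟨ψ, hψX, hψ1, fun x hx => inner_eq_zero_of_nonneg_on _ hM X hpos hψX hψ0 hx⟩

/-- The operator `1 - A + K + e A`; its kernel describes the eigenvalue `-e`. -/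
noncomputable def formPencil (A K : H →L[ℂ] H) (e : ℝ) : H →L[ℂ] H :=
  (1 - A + (e : ℂ) • A) + K

theorem formPencil_re_inner (A K : H →L[ℂ] H) (e : ℝ) (x : H) :
    (inner ℂ x (formPencil A K e x)).re =
      ‖x‖ ^ 2 + (e - 1) * (inner ℂ x (A x)).re + (inner ℂ x (K x)).re := by
  have : (inner ℂ x x : ℂ) = ((‖x‖ ^ 2 : ℝ) : ℂ) := by
    rw [inner_self_eq_norm_sq_to_K]; norm_cast
  simp only [formPencil, add_apply, sub_apply,
    smul_apply, one_apply_eq_self, inner_add_right,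
    inner_sub_right, inner_smul_right, this, Complex.add_re, Complex.sub_re, Complex.mul_re,
    Complex.ofReal_re, Complex.ofReal_im]
  ring

/-- `A` is a nonnegative injective contraction and `K` a compact symmetric operator. -/
structure IsFormPair (A K : H →L[ℂ] H) : Prop where
  symmA : A.IsSymmetric
  nonnegA : ∀ x, 0 ≤ (inner ℂ x (A x)).re
  leA : ∀ x, (inner ℂ x (A x)).re ≤ ‖x‖ ^ 2
  injA : ∀ x, (inner ℂ x (A x)).re = 0 → x = 0
  symmK : K.IsSymmetric
  compactK : IsCompactOperator K

namespace IsFormPair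

variable {A K : H →L[ℂ] H}

theorem symm_coercive (h : IsFormPair A K) (e : ℝ) : (1 - A + (e : ℂ) • A).IsSymmetric := by
  intro x y
  have h1 := h.symmA x y
  simp only [ContinuousLinearMap.coe_coe] at h1
  simp only [ContinuousLinearMap.coe_coe, add_apply, sub_apply, smul_apply,
    one_apply_eq_self, inner_add_left, inner_add_right, inner_sub_left, inner_sub_right,
    inner_smul_left, inner_smul_right, h1, Complex.conj_ofReal]

theorem symm_pencil (h : IsFormPair A K) (e : ℝ) : (formPencil A K e).IsSymmetric := by
  intro x y
  have h1 := h.symm_coercive e x y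
  have h2 := h.symmK x y
  simp only [ContinuousLinearMap.coe_coe] at h1 h2
  simp only [formPencil, ContinuousLinearMap.coe_coe, add_apply _ K,
    inner_add_left, inner_add_right, h1, h2]

/-- The form is ‖x‖² + (e - 1)⟨x, Ax⟩, affine in ⟨x, Ax⟩ ∈ [0, ‖x‖²]; the two end values are ‖x‖²
and e‖x‖². -/
theorem coercive (h : IsFormPair A K) {e : ℝ} (x : H) :
    min 1 e * ‖x‖ ^ 2 ≤ (inner ℂ x ((1 - A + (e : ℂ) • A) x)).re := by
  have h1 := formPencil_re_inner A 0 e x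
  simp only [formPencil, add_zero, zero_apply, inner_zero_right,
    Complex.zero_re] at h1
  rw [h1]
  have h2 := h.nonnegA x
  have h3 := h.leA x
  rcases le_total 1 e with he | he
  · rw [min_eq_left he]; nlinarith
  · rw [min_eq_right he]; nlinarith

variable [CompleteSpace H]

theorem mem_closure_range (h : IsFormPair A K) (y : H) :
    y ∈ closure (Set.range A) := by
  have : (LinearMap.range (A : H →ₗ[ℂ] H)).topologicalClosure = ⊤ := by
    rw [Submodule.topologicalClosure_eq_top_iff, Submodule.eq_bot_iff]
    intro x hx
    apply h.injA
    have := (Submodule.mem_orthogonal' _ _).1 hx (A x) ⟨x, rfl⟩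
    simp [this]
  have hy : y ∈ (LinearMap.range (A : H →ₗ[ℂ] H)).topologicalClosure := by rw [this]; trivial
  have hy' : y ∈ closure ((LinearMap.range (A : H →ₗ[ℂ] H) : Submodule ℂ H) : Set H) := hy
  simpa only [LinearMap.coe_range, ContinuousLinearMap.coe_coe] using hy'

/-- The pencil is nonnegative for large `e`. -/
theorem exists_nonneg (h : IsFormPair A K) :
    ∃ e₁ : ℝ, ∀ e, e₁ ≤ e → ∀ x, 0 ≤ (inner ℂ x (formPencil A K e x)).re := by
  by_contra! hcon
  -- Otherwise there are unit vectors with ⟨x, Ax⟩ → 0 but ⟨x, Kx⟩ < -1. Such vectors become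
  -- orthogonal to the dense range of A, which compactness of K forbids. The choice e ≥ n + 2 makes
  -- e - 1 ≥ n + 1.
  have hx : ∀ n : ℕ, ∃ x : H, ‖x‖ = 1 ∧
      1 + ((n : ℝ) + 1) * (inner ℂ x (A x)).re + (inner ℂ x (K x)).re < 0 := by
    intro n
    obtain ⟨e, he, x, hx⟩ := hcon (n + 2)
    have hx0 : x ≠ 0 := by rintro rfl; simp at hx
    have hn : 0 < ‖x‖ := norm_pos_iff.2 hx0
    rw [formPencil_re_inner] at hx
    have h1 := h.nonnegA x
    have hlt : ‖x‖ ^ 2 + ((n : ℝ) + 1) * (inner ℂ x (A x)).re + (inner ℂ x (K x)).re < 0 := by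
      nlinarith
    refine ⟨((‖x‖⁻¹ : ℝ) : ℂ) • x, ?_, ?_⟩
    · rw [norm_smul]; simp [hn.ne']
    · have sc : ∀ B : H →L[ℂ] H, (inner ℂ (((‖x‖⁻¹ : ℝ) : ℂ) • x) (B (((‖x‖⁻¹ : ℝ) : ℂ) • x))).re
          = (‖x‖⁻¹) ^ 2 * (inner ℂ x (B x)).re := by
        intro B
        rw [map_smul, inner_smul_left, inner_smul_right, Complex.conj_ofReal, ← mul_assoc,
          ← Complex.ofReal_mul, Complex.re_ofReal_mul]; ring
      rw [sc, sc]
      have : (‖x‖⁻¹) ^ 2 * (‖x‖ ^ 2 + ((n : ℝ) + 1) * (inner ℂ x (A x)).re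
          + (inner ℂ x (K x)).re) < 0 := mul_neg_of_pos_of_neg (by positivity) hlt
      have e1 : (‖x‖⁻¹) ^ 2 * ‖x‖ ^ 2 = 1 := by field_simp
      nlinarith
  choose φ hφ1 hφ using hx
  have hKb : ∀ n, -(inner ℂ (φ n) (K (φ n))).re ≤ ‖K‖ := by
    intro n
    calc _ ≤ |(inner ℂ (φ n) (K (φ n))).re| := neg_le_abs _
      _ ≤ ‖inner ℂ (φ n) (K (φ n))‖ := Complex.abs_re_le_norm _
      _ ≤ ‖φ n‖ * ‖K (φ n)‖ := norm_inner_le_norm _ _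
      _ ≤ ‖φ n‖ * (‖K‖ * ‖φ n‖) := by gcongr; exact K.le_opNorm _
      _ = ‖K‖ := by rw [hφ1]; ring
  have hA0 : Tendsto (fun n => (inner ℂ (φ n) (A (φ n))).re) atTop (𝓝 0) := by
    refine squeeze_zero (fun n => h.nonnegA _) (g := fun n : ℕ => ‖K‖ * (1 / ((n : ℝ) + 1))) ?_ ?_
    · intro n
      rw [mul_one_div, le_div_iff₀ (by positivity)]
      have := hφ n; have := hKb n; linarith
    · simpa using (tendsto_one_div_add_atTop_nhds_zero_nat (𝕜 := ℝ)).const_mul ‖K‖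
  -- `⟪φ n, A w⟫ → 0` by Cauchy-Schwarz for the form of `A`
  have hCS : ∀ x w : H, ‖inner ℂ x (A w)‖ ^ 2 ≤ (inner ℂ x (A x)).re * (inner ℂ w (A w)).re := by
    intro x w
    set z := inner ℂ x (A w) with hz
    by_cases hw : (inner ℂ w (A w)).re = 0
    · have := h.injA w hw
      subst this
      simp [hz]
    have hw' : 0 < (inner ℂ w (A w)).re := lt_of_le_of_ne (h.nonnegA w) (Ne.symm hw)
    have := h.nonnegA (x + (-conj z / ((inner ℂ w (A w)).re : ℂ)) • w)
    rw [re_inner_add_smul_of_symmetric A h.symmA, ← hz] at this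
    set s := (inner ℂ w (A w)).re with hs
    have e1 : (-conj z / (s : ℂ) * z).re = -‖z‖ ^ 2 / s := by
      rw [div_mul_eq_mul_div, neg_mul, mul_comm (conj z), Complex.mul_conj,
        Complex.normSq_eq_norm_sq]
      norm_cast
    have e2 : ‖-conj z / (s : ℂ)‖ ^ 2 = ‖z‖ ^ 2 / s ^ 2 := by
      simp [div_pow]
    rw [e1, e2] at this
    have e3 : ‖z‖ ^ 2 / s ^ 2 * s = ‖z‖ ^ 2 / s := by field_simp
    rw [e3] at this
    have h4 : ‖z‖ ^ 2 / s ≤ (inner ℂ x (A x)).re := by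
      have : -‖z‖ ^ 2 / s = -(‖z‖ ^ 2 / s) := by ring
      linarith
    rwa [div_le_iff₀ hw'] at h4
  obtain ⟨y, -, σ, hσ, hy⟩ := (h.compactK.isCompact_closure_image_closedBall
    (f := (K : H →ₗ[ℂ] H)) 1).tendsto_subseq
    (x := fun k => K (φ k)) (fun k => subset_closure ⟨φ k, by simp [hφ1], rfl⟩)
  -- Three errors below 1/4 will bound ⟨φ, Kφ⟩ below 1: the inner product with A w, the distance
  -- from y to A w, and the distance from K φ to its limit y.
  obtain ⟨z, ⟨w, rfl⟩, hw⟩ := Metric.mem_closure_iff.1 (h.mem_closure_range y) (1/4) (by norm_num)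
  have t1 : Tendsto (fun k => ‖inner ℂ (φ (σ k)) (A w)‖ ^ 2) atTop (𝓝 0) := by
    refine squeeze_zero (fun k => sq_nonneg _) (fun k => hCS _ _) ?_
    simpa using (hA0.comp hσ.tendsto_atTop).mul_const (inner ℂ w (A w)).re
  have ev1 := t1.eventually (gt_mem_nhds (show (0:ℝ) < 1/16 by norm_num))
  have ev2 := hy.eventually (Metric.ball_mem_nhds y (show (0:ℝ) < 1/4 by norm_num))
  obtain ⟨k, hk1, hk2⟩ := (ev1.and ev2).exists
  have hk3 : ‖inner ℂ (φ (σ k)) (A w)‖ < 1/4 := by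
    nlinarith [norm_nonneg (inner ℂ (φ (σ k)) (A w))]
  have hk4 : ‖inner ℂ (φ (σ k)) (K (φ (σ k)))‖ < 1 := by
    have : K (φ (σ k)) = A w + ((y - A w) + (K (φ (σ k)) - y)) := by abel
    rw [this, inner_add_right]
    have b1 : ‖inner ℂ (φ (σ k)) ((y - A w) + (K (φ (σ k)) - y))‖ < 1/2 := by
      refine lt_of_le_of_lt (norm_inner_le_norm _ _) ?_
      rw [hφ1, one_mul]
      refine lt_of_le_of_lt (norm_add_le _ _) ?_
      rw [dist_eq_norm] at hw
      have : ‖K (φ (σ k)) - y‖ < 1/4 := by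
        rw [← dist_eq_norm]; exact hk2
      linarith
    refine lt_of_le_of_lt (norm_add_le _ _) ?_
    linarith
  have hk5 := hφ (σ k)
  have hk6 := h.nonnegA (φ (σ k))
  have hk7 : -(inner ℂ (φ (σ k)) (K (φ (σ k)))).re ≤ ‖inner ℂ (φ (σ k)) (K (φ (σ k)))‖ :=
    (neg_le_abs _).trans (Complex.abs_re_le_norm _)
  have : 0 ≤ ((σ k : ℝ) + 1) * (inner ℂ (φ (σ k)) (A (φ (σ k)))).re := by positivity
  linarith

/-- A vector of negative energy in a closed subspace yields a critical point there. -/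
theorem exists_critical (h : IsFormPair A K) (X : Submodule ℂ H) (hX : IsClosed (X : Set H))
    {x₀ : H} (hx₀ : x₀ ∈ X) (hneg : (inner ℂ x₀ (formPencil A K 0 x₀)).re < 0) :
    ∃ e : ℝ, 0 < e ∧ ∃ ψ ∈ X, ‖ψ‖ = 1 ∧ ∀ x ∈ X, inner ℂ x (formPencil A K e ψ) = 0 := by
  obtain ⟨e₁, he₁⟩ := h.exists_nonneg
  -- The critical e is the supremum of P. It is finite by `exists_nonneg` and positive because the
  -- form is still negative slightly above e = 0.
  set P : Set ℝ := {e | ∃ x ∈ X, ‖x‖ = 1 ∧ (inner ℂ x (formPencil A K e x)).re < 0} with hP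
  have hx₀0 : x₀ ≠ 0 := by rintro rfl; simp at hneg
  have hn : 0 < ‖x₀‖ := norm_pos_iff.2 hx₀0
  set x₁ := ((‖x₀‖⁻¹ : ℝ) : ℂ) • x₀ with hx₁
  have hx₁X : x₁ ∈ X := X.smul_mem _ hx₀
  have hx₁1 : ‖x₁‖ = 1 := by rw [hx₁, norm_smul]; simp [hn.ne']
  have hx₁n : (inner ℂ x₁ (formPencil A K 0 x₁)).re < 0 := by
    rw [hx₁, map_smul, inner_smul_left, inner_smul_right, Complex.conj_ofReal, ← mul_assoc,
      ← Complex.ofReal_mul, Complex.re_ofReal_mul]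
    exact mul_neg_of_pos_of_neg (by positivity) hneg
  have hshift : ∀ (e e' : ℝ) (x : H), (inner ℂ x (formPencil A K e' x)).re =
      (inner ℂ x (formPencil A K e x)).re + (e' - e) * (inner ℂ x (A x)).re := by
    intro e e' x; rw [formPencil_re_inner, formPencil_re_inner]; ring
  -- On unit vectors ⟨x, Ax⟩ ≤ 1, so raising e by half of the deficit keeps the value negative. The
  -- same increment below shows that no negative value survives at the supremum.
  set a := -(inner ℂ x₁ (formPencil A K 0 x₁)).re / 2 with ha
  have ha0 : 0 < a := by rw [ha]; linarith
  have haP : a ∈ P := by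
    refine ⟨x₁, hx₁X, hx₁1, ?_⟩
    rw [hshift 0 a]
    have h1 := h.leA x₁
    have h2 := h.nonnegA x₁
    rw [hx₁1] at h1
    nlinarith
  have hbdd : BddAbove P := by
    refine ⟨e₁, fun e ⟨x, _, _, hx⟩ => ?_⟩
    by_contra! hlt
    exact absurd (he₁ e hlt.le x) (not_le.2 hx)
  obtain ⟨u, -, hu, huP⟩ := exists_seq_tendsto_sSup ⟨a, haP⟩ hbdd
  set e := sSup P with he
  have he0 : 0 < e := lt_of_lt_of_le ha0 (le_csSup hbdd haP)
  choose φ hφX hφ1 hφ using huP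
  have hpos : ∀ x ∈ X, 0 ≤ (inner ℂ x (formPencil A K e x)).re := by
    intro x hx
    by_contra! hlt
    have hx0 : x ≠ 0 := by rintro rfl; simp at hlt
    have hxn : 0 < ‖x‖ := norm_pos_iff.2 hx0
    set y := ((‖x‖⁻¹ : ℝ) : ℂ) • x with hy
    have hyX : y ∈ X := X.smul_mem _ hx
    have hy1 : ‖y‖ = 1 := by rw [hy, norm_smul]; simp [hxn.ne']
    have hyn : (inner ℂ y (formPencil A K e y)).re < 0 := by
      rw [hy, map_smul, inner_smul_left, inner_smul_right, Complex.conj_ofReal, ← mul_assoc,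
        ← Complex.ofReal_mul, Complex.re_ofReal_mul]
      exact mul_neg_of_pos_of_neg (by positivity) hlt
    set b := -(inner ℂ y (formPencil A K e y)).re / 2 with hb
    have hb0 : 0 < b := by rw [hb]; linarith
    have : e + b ∈ P := by
      refine ⟨y, hyX, hy1, ?_⟩
      rw [hshift e (e + b)]
      have h1 := h.leA y
      have h2 := h.nonnegA y
      rw [hy1] at h1
      nlinarith
    have := le_csSup hbdd this
    linarith
  -- At `u k` the value is negative, and passing from `u k` to e adds at most e - u k: the φ k form
  -- a minimising sequence.
  have hlim : Tendsto (fun k => (inner ℂ (φ k) (formPencil A K e (φ k))).re) atTop (𝓝 0) := by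
    refine squeeze_zero (g := fun k => e - u k) (fun k => hpos _ (hφX k)) (fun k => ?_) ?_
    · rw [hshift (u k) e]
      have h1 := h.leA (φ k)
      have h2 := h.nonnegA (φ k)
      have h3 : u k ≤ e := le_csSup hbdd ⟨_, hφX k, hφ1 k, hφ k⟩
      rw [hφ1] at h1
      have := hφ k
      nlinarith
    · simpa using hu.const_sub e
  obtain ⟨ψ, h1, h2, h3⟩ := exists_unit_null_vector (1 - A + (e : ℂ) • A) K (h.symm_coercive e)
    h.symmK h.compactK (lt_min one_pos he0) (fun x => h.coercive x) X hX hpos φ hφX hφ1 hlim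
  exact ⟨e, he0, ψ, h1, h2, h3⟩

theorem exists_null (h : IsFormPair A K) {x₀ : H}
    (hneg : (inner ℂ x₀ (formPencil A K 0 x₀)).re < 0) :
    ∃ e : ℝ, 0 < e ∧ ∃ ψ : H, ψ ≠ 0 ∧ formPencil A K e ψ = 0 := by
  obtain ⟨e, he, ψ, -, h1, h2⟩ := h.exists_critical ⊤ isClosed_univ (Submodule.mem_top) hneg
  refine ⟨e, he, ψ, by rintro rfl; simp at h1, ?_⟩
  exact inner_self_eq_zero.1 (h2 _ Submodule.mem_top)

/-- On the kernel (1 - A + eA)x = -Kx, so coercivity controls distances by those of the K-images,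
and the closed unit ball of the kernel is compact. -/
theorem finiteDimensional_ker (h : IsFormPair A K) {e : ℝ} (he : 0 < e) :
    FiniteDimensional ℂ (LinearMap.ker (formPencil A K e : H →ₗ[ℂ] H)) := by
  set X := LinearMap.ker (formPencil A K e : H →ₗ[ℂ] H) with hX
  have hδ : 0 < min 1 e := lt_min one_pos he
  refine FiniteDimensional.of_isCompact_closedBall ℂ (r := 1) one_pos (c := (0 : X)) ?_
  apply IsSeqCompact.isCompact
  intro φ hφ
  have hφ1 : ∀ k, ‖(φ k : H)‖ ≤ 1 := fun k => by simpa using hφ k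
  obtain ⟨y, -, σ, hσ, hy⟩ := (h.compactK.isCompact_closure_image_closedBall
    (f := (K : H →ₗ[ℂ] H)) 1).tendsto_subseq
    (x := fun k => K (φ k)) (fun k => subset_closure ⟨φ k, by simpa using hφ1 k, rfl⟩)
  have hKc : CauchySeq (fun k => K (φ (σ k) : H)) := hy.cauchySeq
  have bound : ∀ k l, min 1 e * ‖(φ k : H) - φ l‖ ^ 2 ≤ 2 * ‖K (φ k) - K (φ l)‖ := by
    intro k l
    have a1 := h.coercive (e := e) ((φ k : H) - φ l)
    have a2 : formPencil A K e ((φ k : H) - φ l) = 0 := (φ k - φ l).2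
    have a3 : (1 - A + (e : ℂ) • A) ((φ k : H) - φ l) = -(K (φ k) - K (φ l)) := by
      rw [formPencil, add_apply] at a2
      rw [eq_neg_of_add_eq_zero_left a2, map_sub]
    rw [a3] at a1
    refine a1.trans ?_
    calc _ ≤ |_| := le_abs_self _
      _ ≤ _ := Complex.abs_re_le_norm _
      _ ≤ ‖(φ k : H) - φ l‖ * ‖-(K (φ k) - K (φ l))‖ := norm_inner_le_norm _ _
      _ ≤ 2 * ‖K (φ k) - K (φ l)‖ := by
        rw [norm_neg]
        gcongr
        refine (norm_sub_le _ _).trans ?_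
        linarith [hφ1 k, hφ1 l]
  have hcau : CauchySeq (φ ∘ σ) := by
    rw [Metric.cauchySeq_iff]
    intro ε hε
    have hη : 0 < min 1 e * ε ^ 2 / 2 := by positivity
    obtain ⟨N, h1⟩ := Metric.cauchySeq_iff.1 hKc _ hη
    refine ⟨N, fun k hk l hl => ?_⟩
    have b := bound (σ k) (σ l)
    have b1 := h1 k hk l hl
    rw [dist_eq_norm] at b1
    have : min 1 e * ‖(φ (σ k) : H) - φ (σ l)‖ ^ 2 < min 1 e * ε ^ 2 := by linarith
    rw [Subtype.dist_eq, dist_eq_norm]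
    exact lt_of_pow_lt_pow_left₀ 2 hε.le (lt_of_mul_lt_mul_left this hδ.le)
  have hXc : IsClosed (X : Set H) := (formPencil A K e).isClosed_ker
  have : CompleteSpace X := hXc.completeSpace_coe
  obtain ⟨ψ, hψ⟩ := cauchySeq_tendsto_of_complete hcau
  exact ⟨ψ, Metric.isClosed_closedBall.mem_of_tendsto hψ (Eventually.of_forall fun k => hφ _),
    σ, hσ, hψ⟩

/-- If the set were finite, the kernels would span a finite-dimensional W. Minimising over (AW)ᗮ,
which amounts to L²-orthogonality to the eigenfunctions already found, gives ψ with M(e)ψ orthogonal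
to (AW)ᗮ. It is also orthogonal to W, since ⟨w, M(e)ψ⟩ = ⟨M(e')w, ψ⟩ + (e - e')⟨w, Aψ⟩ for w in the
kernel of M(e'). As W and (AW)ᗮ span H, ψ is a null vector, lies in W, and is A-orthogonal to
itself. -/
theorem infinite_null (h : IsFormPair A K)
    (hneg : ∀ N : ℕ, ∃ φ : Fin N → H, ∀ c : Fin N → ℂ, c ≠ 0 →
      (inner ℂ (∑ i, c i • φ i) (formPencil A K 0 (∑ i, c i • φ i))).re < 0) :
    {e : ℝ | 0 < e ∧ ∃ ψ : H, ψ ≠ 0 ∧ formPencil A K e ψ = 0}.Infinite := by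
  intro hfin
  set E := {e : ℝ | 0 < e ∧ ∃ ψ : H, ψ ≠ 0 ∧ formPencil A K e ψ = 0} with hE
  have : Finite E := hfin
  let ker : E → Submodule ℂ H := fun e => LinearMap.ker (formPencil A K e : H →ₗ[ℂ] H)
  have : ∀ e : E, FiniteDimensional ℂ (ker e) := fun e => h.finiteDimensional_ker e.2.1
  let W : Submodule ℂ H := ⨆ e : E, ker e
  have hW : FiniteDimensional ℂ W := Submodule.finiteDimensional_iSup ker
  let AW : Submodule ℂ H := W.map (A : H →ₗ[ℂ] H)
  have : FiniteDimensional ℂ AW := inferInstance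
  have hX : IsClosed (AWᗮ : Set H) := Submodule.isClosed_orthogonal _
  obtain ⟨φ, hφ⟩ := hneg (Module.finrank ℂ AW + 1)
  let Φ : (Fin (Module.finrank ℂ AW + 1) → ℂ) →ₗ[ℂ] H := Fintype.linearCombination ℂ φ
  let P : (Fin (Module.finrank ℂ AW + 1) → ℂ) →ₗ[ℂ] AW :=
    (AW.orthogonalProjectionOnto : H →ₗ[ℂ] AW) ∘ₗ Φ
  -- One more direction than dim AW leaves a nonzero combination, still of negative energy, in
  -- (AW)ᗮ.
  have hker : LinearMap.ker P ≠ ⊥ := LinearMap.ker_ne_bot_of_finrank_lt (by simp)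
  obtain ⟨c, hc, hc0⟩ := Submodule.exists_mem_ne_zero_of_ne_bot hker
  have hcX : ∑ i, c i • φ i ∈ AWᗮ := by
    have : AW.orthogonalProjectionOnto (Φ c) = 0 := hc
    rwa [Submodule.orthogonalProjectionOnto_eq_zero_iff, Fintype.linearCombination_apply] at this
  obtain ⟨e, he, ψ, hψX, hψ1, hψ⟩ := h.exists_critical AWᗮ hX hcX (hφ c hc0)
  have hψ0 : ψ ≠ 0 := by rintro rfl; simp at hψ1
  have hWψ : ∀ w ∈ W, inner ℂ w (A ψ) = 0 := by
    intro w hw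
    have := (Submodule.mem_orthogonal _ _).1 hψX (A w) ⟨w, hw, rfl⟩
    rw [← this]; exact (h.symmA w ψ).symm
  have hWM : ∀ w ∈ W, inner ℂ w (formPencil A K e ψ) = 0 := by
    intro w hw
    refine Submodule.iSup_induction (p := ker) (motive := fun w => inner ℂ w (formPencil A K e ψ) = 0)
      hw ?_ (by simp) ?_
    · intro e' w hw'
      have hwW : w ∈ W := (le_iSup ker e') hw'
      have h1 : formPencil A K e' w = 0 := hw'
      have h2 : formPencil A K e ψ = formPencil A K e' ψ + ((e - e' : ℝ) : ℂ) • A ψ := by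
        simp only [formPencil, add_apply, smul_apply]
        push_cast
        module
      rw [h2, inner_add_right, inner_smul_right, hWψ w hwW, mul_zero, add_zero]
      have := h.symm_pencil e' w ψ
      simp only [ContinuousLinearMap.coe_coe] at this
      rw [← this, h1, inner_zero_left]
    · intro x y hx hy
      rw [inner_add_left, hx, hy, add_zero]
  -- This is H = W + (AW)ᗮ. The projection of W to AW is injective because w ⊥ Aw forces w = 0, and
  -- dim AW ≤ dim W.
  have hPW : Function.Surjective ((AW.orthogonalProjectionOnto : H →ₗ[ℂ] AW) ∘ₗ W.subtype) := by
    have hinj : Function.Injective ((AW.orthogonalProjectionOnto : H →ₗ[ℂ] AW) ∘ₗ W.subtype) := by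
      rw [← LinearMap.ker_eq_bot, LinearMap.ker_eq_bot']
      intro w hw
      have h1 : AW.orthogonalProjectionOnto (w : H) = 0 := hw
      rw [Submodule.orthogonalProjectionOnto_eq_zero_iff] at h1
      have h2 := (Submodule.mem_orthogonal' _ _).1 h1 (A w) ⟨w, w.2, rfl⟩
      exact Subtype.ext (h.injA _ (by rw [h2]; rfl))
    exact (LinearMap.injective_iff_surjective_of_finrank_eq_finrank
      (le_antisymm (LinearMap.finrank_le_finrank_of_injective hinj)
        (Submodule.finrank_map_le _ _))).1 hinj
  have hnull : formPencil A K e ψ = 0 := by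
    refine ext_inner_left ℂ fun x => ?_
    obtain ⟨w, hw⟩ := hPW (AW.orthogonalProjectionOnto x)
    have hw' : AW.orthogonalProjectionOnto (w : H) = AW.orthogonalProjectionOnto x := hw
    have hxw : x - w ∈ AWᗮ := by
      rw [← Submodule.orthogonalProjectionOnto_eq_zero_iff, map_sub, hw', sub_self]
    have : x = w + (x - w) := by abel
    rw [this, inner_add_left, hWM w w.2, hψ _ hxw, inner_zero_right, add_zero]
  have hψW : ψ ∈ W := (le_iSup ker ⟨e, he, ψ, hψ0, hnull⟩) hnull
  exact hψ0 (h.injA _ (by rw [hWψ ψ hψW]; rfl))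

end IsFormPair
end FormPencil

/-! ### Multiplication operators on L² and a compactness criterion. -/

section Multiplication

variable {d : ℕ}

theorem memLp_bdd_mul {m : Eucl d → ℂ} (hm : AEStronglyMeasurable m volume)
    (hb : ∀ x, ‖m x‖ ≤ 1) (f : LTwo d) : MemLp (fun x => m x * f x) 2 volume := by
  refine (Lp.memLp f).of_le (hm.mul (Lp.aestronglyMeasurable f)) (.of_forall fun x => ?_)
  rw [norm_mul]
  exact mul_le_of_le_one_left (norm_nonneg _) (hb x)

/-- Multiplication by a bounded function on `L²(ℝ^d)`. -/
noncomputable def mulLp (m : Eucl d → ℂ) (hm : AEStronglyMeasurable m volume)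
    (hb : ∀ x, ‖m x‖ ≤ 1) : LTwo d →L[ℂ] LTwo d :=
  LinearMap.mkContinuous
    { toFun := fun f => (memLp_bdd_mul hm hb f).toLp
        (fun x => m x * f x)
      map_add' := by
        intro f g
        ext1
        filter_upwards [MemLp.coeFn_toLp (memLp_bdd_mul hm hb (f + g)),
          MemLp.coeFn_toLp (memLp_bdd_mul hm hb f),
          MemLp.coeFn_toLp (memLp_bdd_mul hm hb g),
          Lp.coeFn_add f g, Lp.coeFn_add
            ((memLp_bdd_mul hm hb f).toLp (fun x => m x * f x))
            ((memLp_bdd_mul hm hb g).toLp (fun x => m x * g x))]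
          with x h1 h2 h3 h4 h5
        rw [h1, h5, Pi.add_apply, h2, h3, h4, Pi.add_apply, mul_add]
      map_smul' := by
        intro c f
        ext1
        filter_upwards [MemLp.coeFn_toLp (memLp_bdd_mul hm hb (c • f)),
          MemLp.coeFn_toLp (memLp_bdd_mul hm hb f),
          Lp.coeFn_smul c f, Lp.coeFn_smul c
            ((memLp_bdd_mul hm hb f).toLp (fun x => m x * f x))]
          with x h1 h2 h4 h5
        rw [RingHom.id_apply, h1, h5, Pi.smul_apply, h2, h4, Pi.smul_apply, smul_eq_mul,
          smul_eq_mul, mul_left_comm] }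
    1 (by
      intro f
      rw [one_mul]
      refine Lp.norm_le_norm_of_ae_le ?_
      filter_upwards [MemLp.coeFn_toLp (memLp_bdd_mul hm hb f)] with x hx
      simp only [LinearMap.coe_mk, AddHom.coe_mk]
      rw [hx, norm_mul]
      exact mul_le_of_le_one_left (norm_nonneg _) (hb x))

theorem coeFn_mulLp (m : Eucl d → ℂ) (hm : AEStronglyMeasurable m volume)
    (hb : ∀ x, ‖m x‖ ≤ 1) (f : LTwo d) : mulLp m hm hb f =ᵐ[volume] fun x => m x * f x :=
  MemLp.coeFn_toLp (memLp_bdd_mul hm hb f)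

theorem inner_mulLp (m : Eucl d → ℂ) (hm : AEStronglyMeasurable m volume)
    (hb : ∀ x, ‖m x‖ ≤ 1) (f g : LTwo d) :
    inner ℂ f (mulLp m hm hb g) = ∫ x, m x * (conj (f x) * g x) := by
  rw [L2.inner_def]
  refine integral_congr_ae ?_
  filter_upwards [coeFn_mulLp m hm hb g] with x hx
  rw [hx, RCLike.inner_apply]; ring

theorem mulLp_isSymmetric (m : Eucl d → ℝ) (hm : AEStronglyMeasurable (fun x => (m x : ℂ)) volume)
    (hb : ∀ x, ‖(m x : ℂ)‖ ≤ 1) : (mulLp (fun x => (m x : ℂ)) hm hb).IsSymmetric := by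
  intro f g
  simp only [ContinuousLinearMap.coe_coe]
  rw [inner_mulLp, ← inner_conj_symm, inner_mulLp, ← integral_conj]
  refine integral_congr_ae (.of_forall fun x => ?_)
  simp only [map_mul, Complex.conj_conj, Complex.conj_ofReal]; ring

theorem inner_eq_integral (f g : LTwo d) : inner ℂ f g = ∫ x, conj (f x) * g x := by
  rw [L2.inner_def]
  simp only [RCLike.inner_apply, mul_comm]

theorem integrable_conj_mul (f g : LTwo d) : Integrable (fun x => conj (f x) * g x) volume := by
  have := L2.integrable_inner (𝕜 := ℂ) f g
  simpa only [RCLike.inner_apply, mul_comm] using this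

end Multiplication

/-- `B` is compact if `B† B` is. -/
theorem isCompactOperator_of_norm_sq_le {H G : Type*} [NormedAddCommGroup H] [NormedSpace ℂ H]
    [NormedAddCommGroup G] [NormedSpace ℂ G] [CompleteSpace G] (B : H →L[ℂ] G) (K : H →L[ℂ] H)
    (hK : IsCompactOperator K) (h : ∀ x, ‖B x‖ ^ 2 ≤ ‖x‖ * ‖K x‖) : IsCompactOperator B := by
  have key := isCompactOperator_iff_isCompact_closure_image_closedBall (B : H →ₗ[ℂ] G) one_pos
  refine key.2 ?_
  have hKt : TotallyBounded (K '' Metric.closedBall 0 1) :=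
    ((hK.isCompact_closure_image_closedBall (f := (K : H →ₗ[ℂ] H)) 1).totallyBounded).subset
      subset_closure
  refine TotallyBounded.isCompact_of_isClosed (TotallyBounded.closure ?_) isClosed_closure
  rw [Metric.totallyBounded_iff]
  intro ε hε
  -- Radius ε²/2: for x, y in the unit ball, ‖B(x - y)‖² ≤ ‖x - y‖ ‖K(x - y)‖ ≤ 2 ‖K(x - y)‖ < ε².
  -- The net is taken inside the image so that its centres have preimages in the ball.
  obtain ⟨t, hts, htf, ht⟩ := totallyBounded_iff_subset.1 hKt _
    (Metric.dist_mem_uniformity (show 0 < ε ^ 2 / 2 by positivity))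
  obtain ⟨s', hs', hs'f, ht⟩ := Set.exists_subset_image_finite_and (p := fun t => K '' Metric.closedBall 0 1 ⊆
      ⋃ y ∈ t, {x | (x, y) ∈ {p : H × H | dist p.1 p.2 < ε ^ 2 / 2}}).1 ⟨t, hts, htf, ht⟩
  refine ⟨B '' s', hs'f.image _, ?_⟩
  rintro _ ⟨x, hx, rfl⟩
  have hx2 := ht ⟨x, hx, rfl⟩
  simp only [Set.mem_iUnion, Set.mem_ofPred_eq, Set.mem_image, exists_prop,
    exists_exists_and_eq_and] at hx2
  obtain ⟨y, hy, hxy⟩ := hx2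
  have hxy' : dist (K x) (K y) < ε ^ 2 / 2 := hxy
  rw [Set.mem_iUnion₂]
  refine ⟨B y, ⟨y, hy, rfl⟩, ?_⟩
  rw [Metric.mem_ball, dist_eq_norm, ContinuousLinearMap.coe_coe, ← map_sub]
  rw [dist_eq_norm, ← map_sub] at hxy'
  have h1 := h (x - y)
  have h2 : ‖x - y‖ ≤ 2 := by
    refine (norm_sub_le _ _).trans ?_
    have a := hs' hy
    rw [mem_closedBall_zero_iff] at a
    have b : ‖x‖ ≤ 1 := by simpa using hx
    linarith
  have h3 : ‖B (x - y)‖ ^ 2 < ε ^ 2 := by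
    nlinarith [norm_nonneg (K (x - y)), norm_nonneg (x - y)]
  exact lt_of_pow_lt_pow_left₀ 2 hε.le h3

/-! ### The operator (T(p)+1)^{-1/2} and the form domain as its range. -/

section FormSum

variable {d : ℕ}

/-- The symbol `(T(2πξ) + 1)^{-1/2}`. -/
noncomputable def resSymbol (T : Eucl d → ℝ) (ξ : Eucl d) : ℝ :=
  (T ((2 * Real.pi) • ξ) + 1) ^ (-(1 / 2) : ℝ)

variable {T V : Eucl d → ℝ}

theorem resSymbol_pos (hT0 : ∀ η, 0 ≤ T η) (ξ : Eucl d) : 0 < resSymbol T ξ :=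
  Real.rpow_pos_of_pos (by linarith [hT0 ((2 * Real.pi) • ξ)]) _

theorem resSymbol_sq (hT0 : ∀ η, 0 ≤ T η) (ξ : Eucl d) :
    (T ((2 * Real.pi) • ξ) + 1) * resSymbol T ξ ^ 2 = 1 := by
  have : 0 < T ((2 * Real.pi) • ξ) + 1 := by linarith [hT0 ((2 * Real.pi) • ξ)]
  rw [resSymbol, ← Real.rpow_natCast, ← Real.rpow_mul this.le]
  norm_num
  rw [Real.rpow_neg_one]
  exact mul_inv_cancel₀ this.ne'

theorem resSymbol_le_one (hT0 : ∀ η, 0 ≤ T η) (ξ : Eucl d) : ‖(resSymbol T ξ : ℂ)‖ ≤ 1 := by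
  rw [Complex.norm_real, Real.norm_of_nonneg (resSymbol_pos hT0 ξ).le]
  exact Real.rpow_le_one_of_one_le_of_nonpos (by linarith [hT0 ((2 * Real.pi) • ξ)]) (by norm_num)

theorem measurable_scaled (hT : Measurable T) :
    Measurable fun ξ : Eucl d => T ((2 * Real.pi) • ξ) :=
  hT.comp (measurable_const_smul _)

theorem measurable_resSymbol (hT : Measurable T) : Measurable (resSymbol T) :=
  ((measurable_scaled hT).add_const 1).pow_const _

theorem aestronglyMeasurable_resSymbol (hT : Measurable T) :
    AEStronglyMeasurable (fun ξ => (resSymbol T ξ : ℂ)) volume :=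
  (Complex.measurable_ofReal.comp (measurable_resSymbol hT)).aestronglyMeasurable

/-- The operator `(T(p) + 1)^{-1/2}`. -/
noncomputable def resRoot (hT : Measurable T) (hT0 : ∀ η, 0 ≤ T η) : LTwo d →L[ℂ] LTwo d :=
  ((Lp.fourierTransformₗᵢ (Eucl d) ℂ).symm.toContinuousLinearEquiv : LTwo d →L[ℂ] LTwo d) ∘L
    mulLp _ (aestronglyMeasurable_resSymbol hT) (resSymbol_le_one hT0) ∘L
    ((Lp.fourierTransformₗᵢ (Eucl d) ℂ).toContinuousLinearEquiv : LTwo d →L[ℂ] LTwo d)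

variable (hT : Measurable T) (hT0 : ∀ η, 0 ≤ T η)

theorem fourier_resRoot (f : LTwo d) : (𝓕 (resRoot hT hT0 f) : LTwo d) =
    mulLp _ (aestronglyMeasurable_resSymbol hT) (resSymbol_le_one hT0) (𝓕 f : LTwo d) :=
  (Lp.fourierTransformₗᵢ (Eucl d) ℂ).apply_symm_apply _

theorem coeFn_fourier_resRoot (f : LTwo d) : (𝓕 (resRoot hT hT0 f) : LTwo d) =ᵐ[volume]
    fun ξ => (resSymbol T ξ : ℂ) * (𝓕 f : LTwo d) ξ := by
  rw [fourier_resRoot]; exact coeFn_mulLp _ _ _ _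

theorem isFourierMultiplier_resRoot (f : LTwo d) :
    IsFourierMultiplier (fun η => (T η + 1) ^ (-(1 / 2) : ℝ)) f (resRoot hT hT0 f) :=
  coeFn_fourier_resRoot hT hT0 f

theorem inner_fourier (f g : LTwo d) :
    inner ℂ (𝓕 f : LTwo d) (𝓕 g : LTwo d) = inner ℂ f g :=
  (Lp.fourierTransformₗᵢ (Eucl d) ℂ).inner_map_map f g

theorem resRoot_isSymmetric : (resRoot hT hT0).IsSymmetric := by
  intro f g
  simp only [ContinuousLinearMap.coe_coe]
  rw [← inner_fourier, ← inner_fourier f, fourier_resRoot, fourier_resRoot]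
  exact mulLp_isSymmetric (resSymbol T) (aestronglyMeasurable_resSymbol hT)
    (resSymbol_le_one hT0) _ _

theorem resRoot_injective : Function.Injective (resRoot hT hT0) := by
  rw [injective_iff_map_eq_zero]
  intro f hf
  have h := coeFn_fourier_resRoot hT hT0 f
  rw [hf] at h
  have h0 : (𝓕 (0 : LTwo d) : LTwo d) = 0 := (Lp.fourierTransformₗᵢ (Eucl d) ℂ).map_zero
  rw [h0] at h
  have : (𝓕 f : LTwo d) = 0 := by
    rw [Lp.eq_zero_iff_ae_eq_zero]
    filter_upwards [h, Lp.coeFn_zero ℂ 2 (volume : Measure (Eucl d))] with ξ h1 h2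
    rw [h2] at h1
    have := (resSymbol_pos hT0 ξ).ne'
    simpa [this] using h1.symm
  exact (Lp.fourierTransformₗᵢ (Eucl d) ℂ).map_eq_zero_iff.1 this

theorem norm_resRoot_le (f : LTwo d) : ‖resRoot hT hT0 f‖ ≤ ‖f‖ := by
  rw [← Lp.norm_fourier_eq, ← Lp.norm_fourier_eq f]
  refine Lp.norm_le_norm_of_ae_le ?_
  filter_upwards [coeFn_fourier_resRoot hT hT0 f] with x hx
  rw [hx, norm_mul]
  exact mul_le_of_le_one_left (norm_nonneg _) (resSymbol_le_one hT0 x)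

theorem resRoot_mem_formDomain (φ : LTwo d) : resRoot hT hT0 φ ∈ formDomain T := by
  have h := (Lp.memLp (𝓕 φ : LTwo d)).integrable_norm_pow (by norm_num)
  refine h.mono' (((measurable_scaled hT).aestronglyMeasurable).mul
    ((Lp.aestronglyMeasurable _).norm.pow 2)) ?_
  filter_upwards [coeFn_fourier_resRoot hT hT0 φ] with ξ hξ
  have e : ‖(resSymbol T ξ : ℂ)‖ ^ 2 = resSymbol T ξ ^ 2 := by
    rw [Complex.norm_real, Real.norm_eq_abs, sq_abs]
  rw [hξ, norm_mul (_ : ℂ), mul_pow, e, ← mul_assoc, norm_mul,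
    Real.norm_of_nonneg (mul_nonneg (hT0 _) (sq_nonneg _)), norm_pow, norm_norm]
  have := resSymbol_sq hT0 ξ
  refine mul_le_of_le_one_left (by positivity) ?_
  nlinarith [sq_nonneg (resSymbol T ξ)]

/-- Dividing the Fourier transform by the symbol stays in L² because the inverse square of the
symbol is T + 1. Thus the substitution f = Rφ reaches the whole form domain and replaces unbounded
forms by bounded operators. -/
theorem exists_resRoot_eq {f : LTwo d} (hf : f ∈ formDomain T) :
    ∃ φ : LTwo d, resRoot hT hT0 φ = f := by
  have hm : MemLp (fun ξ => (((resSymbol T ξ)⁻¹ : ℝ) : ℂ) * (𝓕 f : LTwo d) ξ) 2 volume := by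
    rw [memLp_two_iff_integrable_sq_norm]
    · have h2 := (Lp.memLp (𝓕 f : LTwo d)).integrable_norm_pow (by norm_num)
      refine (Integrable.add hf h2).congr (.of_forall fun ξ => ?_)
      have h3 := resSymbol_sq hT0 ξ
      have h4 := (resSymbol_pos hT0 ξ).ne'
      simp only [Pi.add_apply, norm_mul, Complex.norm_real, mul_pow, norm_inv, inv_pow,
        Real.norm_eq_abs, sq_abs]
      have : (resSymbol T ξ ^ 2)⁻¹ = T ((2 * Real.pi) • ξ) + 1 :=
        inv_eq_of_mul_eq_one_left h3
      rw [this]; ring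
    · exact (Complex.measurable_ofReal.comp
        (measurable_resSymbol hT).inv).aestronglyMeasurable.mul (Lp.aestronglyMeasurable _)
  refine ⟨(Lp.fourierTransformₗᵢ (Eucl d) ℂ).symm hm.toLp, ?_⟩
  apply (Lp.fourierTransformₗᵢ (Eucl d) ℂ).injective
  have h0 : (𝓕 ((Lp.fourierTransformₗᵢ (Eucl d) ℂ).symm hm.toLp) : LTwo d) = hm.toLp :=
    (Lp.fourierTransformₗᵢ (Eucl d) ℂ).apply_symm_apply _
  have h1 := coeFn_fourier_resRoot hT hT0 ((Lp.fourierTransformₗᵢ (Eucl d) ℂ).symm hm.toLp)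
  rw [h0] at h1
  refine Lp.ext ?_
  refine h1.trans ?_
  filter_upwards [hm.coeFn_toLp] with ξ hξ
  rw [hξ, ← mul_assoc, ← Complex.ofReal_mul, mul_inv_cancel₀ (resSymbol_pos hT0 ξ).ne']
  simp only [Complex.ofReal_one, one_mul]
  rfl

end FormSum

/-! ### From the Schrödinger form to the pencil. -/

section FormSum

variable {d : ℕ} {T V : Eucl d → ℝ}

/-- Bounded operators representing the forms of `|V|` and `V` on the range of `(T(p)+1)^{-1/2}`. -/
theorem exists_potential_operator (hT : Measurable T) (hT0 : ∀ η, 0 ≤ T η)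
    (hV : AEMeasurable V volume) (hTV : IsRelFormCompact T V) :
    ∃ K : LTwo d →L[ℂ] LTwo d, IsCompactOperator K ∧ K.IsSymmetric ∧ ∀ φ ψ : LTwo d,
      inner ℂ ψ (K φ) = ∫ x, (V x : ℂ) * (conj (resRoot hT hT0 ψ x) * resRoot hT hT0 φ x) := by
  obtain ⟨K, hKc, hK⟩ := hTV
  have hK' := fun f g => hK f g _ _ (isFourierMultiplier_resRoot hT hT0 f)
    (isFourierMultiplier_resRoot hT hT0 g)
  set R := resRoot hT hT0 with hR
  have hVm : AEStronglyMeasurable (fun x => ((√|V x| : ℝ) : ℂ)) volume :=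
    (Complex.measurable_ofReal.comp_aemeasurable
      (hV.abs.sqrt)).aestronglyMeasurable
  have hsq : ∀ x, ((√|V x| : ℝ) : ℂ) * ((√|V x| : ℝ) : ℂ) = ((|V x| : ℝ) : ℂ) := by
    intro x
    rw [← Complex.ofReal_mul, Real.mul_self_sqrt (abs_nonneg _)]
  have hmem : ∀ f, MemLp (fun x => ((√|V x| : ℝ) : ℂ) * R f x) 2 volume := by
    intro f
    have hm : AEStronglyMeasurable (fun x => ((√|V x| : ℝ) : ℂ) * R f x) volume :=
      hVm.mul (Lp.aestronglyMeasurable _)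
    rw [memLp_two_iff_integrable_sq_norm hm]
    refine ((hK' f f).1.norm).congr (.of_forall fun x => ?_)
    simp only [norm_mul, Complex.norm_real, RCLike.norm_conj, mul_pow, Real.norm_eq_abs, sq_abs,
      Real.sq_sqrt (abs_nonneg _), abs_abs]
    ring
  let B₀ : LTwo d →ₗ[ℂ] LTwo d :=
    { toFun := fun f => (hmem f).toLp
      map_add' := by
        intro f g
        ext1
        filter_upwards [(hmem (f + g)).coeFn_toLp, (hmem f).coeFn_toLp, (hmem g).coeFn_toLp,
          Lp.coeFn_add (hmem f).toLp (hmem g).toLp, Lp.coeFn_add (R f) (R g)] with x h1 h2 h3 h4 h5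
        rw [h1, h4, Pi.add_apply, h2, h3, map_add, h5, Pi.add_apply, mul_add]
      map_smul' := by
        intro c f
        ext1
        filter_upwards [(hmem (c • f)).coeFn_toLp, (hmem f).coeFn_toLp,
          Lp.coeFn_smul c (hmem f).toLp, Lp.coeFn_smul c (R f)] with x h1 h2 h4 h5
        rw [RingHom.id_apply, h1, h4, Pi.smul_apply, h2, map_smul, h5, Pi.smul_apply, smul_eq_mul,
          smul_eq_mul, mul_left_comm] }
  have hB₀ : ∀ f, B₀ f =ᵐ[volume] fun x => ((√|V x| : ℝ) : ℂ) * R f x := fun f =>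
    (hmem f).coeFn_toLp
  -- With B = √|V| R this says B†B is the given compact operator, hence B is compact. The form of V
  -- is then B† sgn(V) B, which handles a V of variable sign.
  have hBK : ∀ f g, inner ℂ (B₀ f) (B₀ g) = inner ℂ f (K g) := by
    intro f g
    rw [(hK' f g).2, inner_eq_integral]
    refine integral_congr_ae ?_
    filter_upwards [hB₀ f, hB₀ g] with x h1 h2
    rw [h1, h2, map_mul, Complex.conj_ofReal, ← hsq]; ring
  have hBn : ∀ f, ‖B₀ f‖ ^ 2 ≤ ‖f‖ * ‖K f‖ := by
    intro f
    have h1 : (inner ℂ (B₀ f) (B₀ f)).re = ‖B₀ f‖ ^ 2 := by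
      rw [inner_self_eq_norm_sq_to_K]; norm_cast
    rw [← h1, hBK]
    exact ((le_abs_self _).trans (Complex.abs_re_le_norm _)).trans (norm_inner_le_norm _ _)
  let B : LTwo d →L[ℂ] LTwo d := B₀.mkContinuous √‖K‖ (by
    intro f
    refine (sq_le_sq₀ (norm_nonneg _) (by positivity)).1 ?_
    rw [mul_pow, Real.sq_sqrt (norm_nonneg _)]
    refine (hBn f).trans ?_
    calc _ ≤ ‖f‖ * (‖K‖ * ‖f‖) := by gcongr; exact K.le_opNorm _
      _ = _ := by ring)
  have hBc : IsCompactOperator B := isCompactOperator_of_norm_sq_le B K hKc hBn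
  -- V / |V| is the sign of V; division by zero gives 0 where V vanishes.
  have hsm : AEStronglyMeasurable (fun x => ((V x / |V x| : ℝ) : ℂ)) volume := by
    exact (Complex.measurable_ofReal.comp_aemeasurable (hV.div hV.abs)).aestronglyMeasurable
  have hsb : ∀ x, ‖((V x / |V x| : ℝ) : ℂ)‖ ≤ 1 := by
    intro x
    rw [Complex.norm_real, norm_div, Real.norm_eq_abs, Real.norm_eq_abs, abs_abs]
    exact div_self_le_one _
  set S := mulLp (fun x => ((V x / |V x| : ℝ) : ℂ)) hsm hsb with hS
  have hSs : S.IsSymmetric := mulLp_isSymmetric (fun x => (V x / |V x| : ℝ)) hsm hsb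
  refine ⟨ContinuousLinearMap.adjoint B ∘L S ∘L B,
    (hBc.clm_comp S).clm_comp (ContinuousLinearMap.adjoint B), ?_, ?_⟩
  · intro f g
    have := hSs (B f) (B g)
    simp only [ContinuousLinearMap.coe_coe] at this
    simp only [ContinuousLinearMap.coe_coe, ContinuousLinearMap.comp_apply,
      ContinuousLinearMap.adjoint_inner_left, ContinuousLinearMap.adjoint_inner_right, this]
  · intro φ ψ
    simp only [ContinuousLinearMap.comp_apply, ContinuousLinearMap.adjoint_inner_right]
    rw [hS, inner_mulLp]
    refine integral_congr_ae ?_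
    filter_upwards [hB₀ φ, hB₀ ψ] with x h1 h2
    change _ * (conj (B₀ ψ x) * B₀ φ x) = _
    rw [h1, h2, map_mul, Complex.conj_ofReal]
    have : (V x : ℂ) = ((V x / |V x| : ℝ) : ℂ) *
        (((√|V x| : ℝ) : ℂ) * ((√|V x| : ℝ) : ℂ)) := by
      rw [hsq, ← Complex.ofReal_mul, div_mul_cancel_of_imp (fun h => abs_eq_zero.1 h)]
    rw [this]; ring

theorem integrable_potential (hT : Measurable T) (hT0 : ∀ η, 0 ≤ T η)
    (hV : AEMeasurable V volume) (hTV : IsRelFormCompact T V) {f g : LTwo d}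
    (hf : f ∈ formDomain T) (hg : g ∈ formDomain T) :
    Integrable (fun x => (V x : ℂ) * (conj (f x) * g x)) volume := by
  obtain ⟨φ, rfl⟩ := exists_resRoot_eq hT hT0 hf
  obtain ⟨ψ, rfl⟩ := exists_resRoot_eq hT hT0 hg
  obtain ⟨K, hKc, hK⟩ := hTV
  have h := (hK φ ψ _ _ (isFourierMultiplier_resRoot hT hT0 φ)
    (isFourierMultiplier_resRoot hT hT0 ψ)).1
  refine h.mono ?_ (.of_forall fun x => ?_)
  · exact ((Complex.measurable_ofReal.comp_aemeasurable hV).aestronglyMeasurable).mul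
      ((Complex.continuous_conj.comp_aestronglyMeasurable (Lp.aestronglyMeasurable _)).mul
        (Lp.aestronglyMeasurable _))
  · simp

/-- The symbol ρ of R satisfies (T + 1)ρ² = 1, so Tρ² = 1 - ρ² and the kinetic form becomes that of
1 - R². -/
theorem energyForm_resRoot (hT : Measurable T) (hT0 : ∀ η, 0 ≤ T η) {K : LTwo d →L[ℂ] LTwo d}
    (hK : ∀ φ ψ : LTwo d, inner ℂ ψ (K φ) =
      ∫ x, (V x : ℂ) * (conj (resRoot hT hT0 ψ x) * resRoot hT hT0 φ x)) (φ ψ : LTwo d) :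
    energyForm T V (resRoot hT hT0 ψ) (resRoot hT hT0 φ) =
      inner ℂ ψ (formPencil (resRoot hT hT0 ∘L resRoot hT hT0) K 0 φ) := by
  set R := resRoot hT hT0 with hR
  have hs : ∀ x y, inner ℂ (R x) y = inner ℂ x (R y) := fun x y => resRoot_isSymmetric hT hT0 x y
  have h1 : inner ℂ ψ (formPencil (R ∘L R) K 0 φ) =
      (inner ℂ (𝓕 ψ : LTwo d) (𝓕 φ : LTwo d) - inner ℂ (𝓕 (R ψ) : LTwo d) (𝓕 (R φ) : LTwo d)) +
        inner ℂ ψ (K φ) := by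
    simp [formPencil, inner_add_right, inner_sub_right, hs]
  rw [h1, hK, energyForm, inner_eq_integral, inner_eq_integral,
    ← integral_sub (integrable_conj_mul _ _) (integrable_conj_mul _ _)]
  congr 1
  refine integral_congr_ae ?_
  filter_upwards [coeFn_fourier_resRoot hT hT0 φ, coeFn_fourier_resRoot hT hT0 ψ] with ξ h2 h3
  rw [h2, h3, map_mul, Complex.conj_ofReal]
  have h4 : ((T ((2 * Real.pi) • ξ) : ℂ) + 1) * (resSymbol T ξ : ℂ) ^ 2 = 1 := by
    exact_mod_cast congrArg (fun x : ℝ => (x : ℂ)) (resSymbol_sq hT0 ξ)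
  linear_combination (conj ((𝓕 ψ : LTwo d) ξ) * (𝓕 φ : LTwo d) ξ) * h4

theorem resRoot_isFormPair (hT : Measurable T) (hT0 : ∀ η, 0 ≤ T η) {K : LTwo d →L[ℂ] LTwo d}
    (hKc : IsCompactOperator K) (hKs : K.IsSymmetric) :
    IsFormPair (resRoot hT hT0 ∘L resRoot hT hT0) K := by
  have hs : ∀ x y, inner ℂ (resRoot hT hT0 x) y = inner ℂ x (resRoot hT hT0 y) :=
    fun x y => resRoot_isSymmetric hT hT0 x y
  have hn : ∀ x, (inner ℂ x ((resRoot hT hT0 ∘L resRoot hT hT0) x)).re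
      = ‖resRoot hT hT0 x‖ ^ 2 := by
    intro x
    rw [ContinuousLinearMap.comp_apply, ← hs, inner_self_eq_norm_sq_to_K]; norm_cast
  refine ⟨?_, fun x => by rw [hn]; positivity, fun x => ?_, fun x hx => ?_, hKs, hKc⟩
  · intro x y
    simp [hs]
  · rw [hn]
    gcongr
    exact norm_resRoot_le hT hT0 x
  · rw [hn] at hx
    have : resRoot hT hT0 x = 0 := by simpa using hx
    exact resRoot_injective hT hT0 (by rw [this, map_zero])

/-- A null vector satisfies M(0)φ = -e R²φ. Pairing with ψ gives energy -e⟨Rψ, Rφ⟩, and Rψ runs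
through the form domain. -/
theorem isSchrodingerEigenvalue_of_pencil (hT : Measurable T) (hT0 : ∀ η, 0 ≤ T η)
    {K : LTwo d →L[ℂ] LTwo d}
    (hK : ∀ φ ψ : LTwo d, inner ℂ ψ (K φ) =
      ∫ x, (V x : ℂ) * (conj (resRoot hT hT0 ψ x) * resRoot hT hT0 φ x)) {e : ℝ} {φ : LTwo d}
    (hφ0 : φ ≠ 0) (hφ : formPencil (resRoot hT hT0 ∘L resRoot hT hT0) K e φ = 0) :
    IsSchrodingerEigenvalue T V (-e) := by
  refine ⟨resRoot hT hT0 φ, fun h => hφ0 (resRoot_injective hT hT0 (by rw [h, map_zero])),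
    resRoot_mem_formDomain hT hT0 φ, fun g hg => ?_⟩
  obtain ⟨ψ, rfl⟩ := exists_resRoot_eq hT hT0 hg
  simp only
  rw [energyForm_resRoot hT hT0 hK]
  have : formPencil (resRoot hT hT0 ∘L resRoot hT hT0) K 0 φ =
      -((e : ℂ) • (resRoot hT hT0 (resRoot hT hT0 φ))) := by
    rw [← zero_sub, ← hφ]
    simp only [formPencil, add_apply, sub_apply, smul_apply, ContinuousLinearMap.comp_apply,
      Complex.ofReal_zero, zero_smul, add_zero]
    abel
  have hs : inner ℂ (resRoot hT hT0 ψ) (resRoot hT hT0 φ) =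
    inner ℂ ψ (resRoot hT hT0 (resRoot hT hT0 φ)) := resRoot_isSymmetric hT hT0 _ _
  rw [this, inner_neg_right, inner_smul_right, inner_smul_right, hs]
  push_cast
  ring

theorem add_mem_formDomain (hT : Measurable T) (hT0 : ∀ η, 0 ≤ T η) {f g : LTwo d}
    (hf : f ∈ formDomain T) (hg : g ∈ formDomain T) : f + g ∈ formDomain T := by
  obtain ⟨φ, rfl⟩ := exists_resRoot_eq hT hT0 hf
  obtain ⟨ψ, rfl⟩ := exists_resRoot_eq hT hT0 hg
  rw [← map_add]; exact resRoot_mem_formDomain hT hT0 _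

theorem smul_mem_formDomain (hT : Measurable T) (hT0 : ∀ η, 0 ≤ T η) {f : LTwo d} (c : ℂ)
    (hf : f ∈ formDomain T) : c • f ∈ formDomain T := by
  obtain ⟨φ, rfl⟩ := exists_resRoot_eq hT hT0 hf
  rw [← map_smul]; exact resRoot_mem_formDomain hT hT0 _

theorem exists_negative_eigenvalue (hT : Measurable T) (hT0 : ∀ η, 0 ≤ T η)
    (hV : AEMeasurable V volume) (hTV : IsRelFormCompact T V) {f : LTwo d}
    (hf : f ∈ formDomain T) (hneg : (energyForm T V f f).re < 0) :
    ∃ E : ℝ, E < 0 ∧ IsSchrodingerEigenvalue T V E := by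
  obtain ⟨K, hKc, hKs, hK⟩ := exists_potential_operator hT hT0 hV hTV
  obtain ⟨φ, rfl⟩ := exists_resRoot_eq hT hT0 hf
  rw [energyForm_resRoot hT hT0 hK] at hneg
  obtain ⟨e, he, ψ, hψ0, hψ⟩ := (resRoot_isFormPair hT hT0 hKc hKs).exists_null hneg
  exact ⟨-e, by linarith, isSchrodingerEigenvalue_of_pencil hT hT0 hK hψ0 hψ⟩

theorem infinite_negative_eigenvalues (hT : Measurable T) (hT0 : ∀ η, 0 ≤ T η)
    (hV : AEMeasurable V volume) (hTV : IsRelFormCompact T V)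
    (hneg : ∀ N : ℕ, ∃ f : Fin N → LTwo d, (∀ i, f i ∈ formDomain T) ∧
      ∀ c : Fin N → ℂ, c ≠ 0 → (energyForm T V (∑ i, c i • f i) (∑ i, c i • f i)).re < 0) :
    {E : ℝ | E < 0 ∧ IsSchrodingerEigenvalue T V E}.Infinite := by
  obtain ⟨K, hKc, hKs, hK⟩ := exists_potential_operator hT hT0 hV hTV
  have hinf := (resRoot_isFormPair hT hT0 hKc hKs).infinite_null (by
    intro N
    obtain ⟨f, hf, hc⟩ := hneg N
    choose φ hφ using fun i => exists_resRoot_eq hT hT0 (hf i)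
    refine ⟨φ, fun c hc0 => ?_⟩
    rw [← energyForm_resRoot hT hT0 hK]
    simpa only [map_sum, map_smul, hφ] using hc c hc0)
  refine (hinf.image (neg_injective.injOn)).mono ?_
  rintro _ ⟨e, ⟨he, ψ, hψ0, hψ⟩, rfl⟩
  exact ⟨by simpa using he, isSchrodingerEigenvalue_of_pencil hT hT0 hK hψ0 hψ⟩

/-- Expansion of the energy of `f + c g`. -/
theorem energyForm_add_smul (hT : Measurable T) (hT0 : ∀ η, 0 ≤ T η)
    (hV : AEMeasurable V volume) (hTV : IsRelFormCompact T V) {f g : LTwo d}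
    (hf : f ∈ formDomain T) (hg : g ∈ formDomain T) (c : ℂ) :
    (energyForm T V (f + c • g) (f + c • g)).re = (energyForm T V f f).re +
      2 * (c * energyForm T V f g).re + ‖c‖ ^ 2 * (energyForm T V g g).re := by
  obtain ⟨K, hKc, hKs, hK⟩ := exists_potential_operator hT hT0 hV hTV
  obtain ⟨φ, rfl⟩ := exists_resRoot_eq hT hT0 hf
  obtain ⟨ψ, rfl⟩ := exists_resRoot_eq hT hT0 hg
  rw [← map_smul, ← map_add]
  simp only [energyForm_resRoot hT hT0 hK]
  exact re_inner_add_smul_of_symmetric _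
    ((resRoot_isFormPair hT hT0 hKc hKs).symm_pencil 0) φ ψ c

theorem re_energyForm_self (f : LTwo d) : (energyForm T V f f).re =
    (∫ ξ, T ((2 * Real.pi) • ξ) * ‖(𝓕 f : LTwo d) ξ‖ ^ 2) + ∫ x, V x * ‖f x‖ ^ 2 := by
  have aux : ∀ (v : Eucl d → ℝ) (h : Eucl d → ℂ),
      ∫ x, (v x : ℂ) * (conj (h x) * h x) = ((∫ x, v x * ‖h x‖ ^ 2 : ℝ) : ℂ) := by
    intro v h
    rw [← integral_complex_ofReal]
    refine integral_congr_ae (.of_forall fun x => ?_)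
    simp only
    rw [mul_comm (conj _), Complex.mul_conj, Complex.normSq_eq_norm_sq]
    push_cast; ring
  rw [energyForm, aux V, aux fun ξ => T ((2 * Real.pi) • ξ)]
  simp

end FormSum

/-! ### Inverse Fourier integrals and plane waves. -/

section FourierLOneLTwo

open Filter Topology
open scoped ContDiff RealInnerProductSpace

variable {d : ℕ}

theorem continuous_uncurry_innerₗ : Continuous fun p : Eucl d × Eucl d => (-innerₗ (Eucl d)) p.1 p.2 := by
  have : (fun p : Eucl d × Eucl d => (-innerₗ (Eucl d)) p.1 p.2) = fun p => -inner ℝ p.1 p.2 := by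
    ext p; simp
  rw [this]; fun_prop

theorem integral_fourierInv_mul (f g : Eucl d → ℂ) (hf : Integrable f volume)
    (hg : Integrable g volume) : ∫ x, 𝓕⁻ f x * g x = ∫ x, f x * 𝓕⁻ g x := by
  have h := VectorFourier.integral_fourierIntegral_smul_eq_flip (L := -innerₗ (Eucl d))
    (μ := volume) (ν := volume) (f := f) (g := g) Real.continuous_fourierChar
    continuous_uncurry_innerₗ hf hg
  have hflip : (-innerₗ (Eucl d)).flip = -innerₗ (Eucl d) := by
    ext x y; simp [real_inner_comm]
  rw [hflip] at h
  exact h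

theorem continuous_fourierInv {f : Eucl d → ℂ} (hf : Integrable f volume) : Continuous (𝓕⁻ f) :=
  VectorFourier.fourierIntegral_continuous Real.continuous_fourierChar
    continuous_uncurry_innerₗ hf

theorem norm_fourierInv_le (f : Eucl d → ℂ) (x : Eucl d) : ‖𝓕⁻ f x‖ ≤ ∫ v, ‖f v‖ :=
  VectorFourier.norm_fourierIntegral_le_integral_norm _ _ _ _ _

/-- The `L²` inverse Fourier transform of an integrable function is given by the integral. -/
theorem coeFn_fourierInv_of_integrable (u : LTwo d) (hu : Integrable u volume) :
    (𝓕⁻ u : LTwo d) =ᵐ[volume] 𝓕⁻ (u : Eucl d → ℂ) := by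
  refine ae_eq_of_integral_contDiff_smul_eq
    ((Lp.memLp (𝓕⁻ u : LTwo d)).locallyIntegrable (by norm_num))
    (continuous_fourierInv hu).locallyIntegrable ?_
  intro g hg hgc
  have hg₁ : HasCompactSupport (Complex.ofRealCLM ∘ g) := hgc.comp_left rfl
  have hg₂ : ContDiff ℝ ∞ (Complex.ofRealCLM ∘ g) := by fun_prop
  -- The L² transform agrees with the distributional one, so testing against smooth compactly
  -- supported functions moves the transform onto g, and the multiplication formula moves it back as
  -- an integral.
  have h1 := congrArg (fun t => t (hg₁.toSchwartzMap hg₂)) (Lp.fourierInv_toTemperedDistribution_eq u)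
  simp only [TemperedDistribution.fourierInv_apply, Lp.toTemperedDistribution_apply] at h1
  have h2 : ∀ x, (hg₁.toSchwartzMap hg₂) x = (g x : ℂ) := fun x => rfl
  have h3 : ∀ x, (𝓕⁻ (hg₁.toSchwartzMap hg₂)) x = 𝓕⁻ (fun x => (g x : ℂ)) x := by
    intro x
    rw [SchwartzMap.fourierInv_coe]
    rfl
  simp only [h2, h3, smul_eq_mul] at h1
  simp only [Complex.real_smul]
  rw [← h1]
  refine integral_fourierInv_mul _ _ ?_ hu
  exact (hg₁.toSchwartzMap hg₂).integrable

/-- An integrable function whose inverse Fourier transform vanishes is zero. -/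
theorem ae_eq_zero_of_fourierInv_ae_eq_zero {W : Eucl d → ℂ} (hW : Integrable W volume)
    (h : 𝓕⁻ W =ᵐ[volume] 0) : W =ᵐ[volume] 0 := by
  refine ae_eq_zero_of_integral_contDiff_smul_eq_zero hW.locallyIntegrable ?_
  intro g hg hgc
  have hg₁ : HasCompactSupport (Complex.ofRealCLM ∘ g) := hgc.comp_left rfl
  have hg₂ : ContDiff ℝ ∞ (Complex.ofRealCLM ∘ g) := by fun_prop
  have h1 : ∀ x, (g x : ℂ) = 𝓕⁻ (𝓕 (hg₁.toSchwartzMap hg₂) : SchwartzMap (Eucl d) ℂ) x := by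
    intro x
    rw [fourierInv_fourier_eq]
    rfl
  simp only [Complex.real_smul]
  have h2 := integral_fourierInv_mul (𝓕 (hg₁.toSchwartzMap hg₂) : SchwartzMap (Eucl d) ℂ) W
    (𝓕 (hg₁.toSchwartzMap hg₂) : SchwartzMap (Eucl d) ℂ).integrable hW
  calc ∫ x, (g x : ℂ) * W x = _ := by
        simp_rw [h1, SchwartzMap.fourierInv_coe]
    _ = _ := h2
    _ = 0 := by
      rw [integral_eq_zero_of_ae]
      filter_upwards [h] with x hx
      simp [hx]

/-- The plane wave `exp(2πi⟪ξ, x⟫)`. -/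
noncomputable def planeWave (ξ x : Eucl d) : ℂ := (Real.fourierChar (inner ℝ ξ x) : ℂ)

theorem norm_planeWave (ξ x : Eucl d) : ‖planeWave ξ x‖ = 1 := Circle.norm_coe _

theorem planeWave_eq_exp (ξ x : Eucl d) :
    planeWave ξ x = Complex.exp (Complex.I * ((2 * Real.pi * inner ℝ ξ x : ℝ) : ℂ)) := by
  rw [planeWave, Real.fourierChar_apply]; congr 1; ring

theorem continuous_planeWave : Continuous fun p : Eucl d × Eucl d => planeWave p.1 p.2 := by
  simp only [planeWave_eq_exp]; fun_prop

theorem norm_planeWave_sub_le (ξ η x : Eucl d) :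
    ‖planeWave ξ x - planeWave η x‖ ≤ 2 * Real.pi * ‖ξ - η‖ * ‖x‖ := by
  have h : planeWave ξ x - planeWave η x = planeWave η x *
      (Complex.exp (Complex.I * ((2 * Real.pi * inner ℝ (ξ - η) x : ℝ) : ℂ)) - 1) := by
    rw [planeWave_eq_exp, planeWave_eq_exp, mul_sub, mul_one, ← Complex.exp_add, inner_sub_left]
    congr 2
    push_cast; ring
  rw [h, norm_mul, norm_planeWave, one_mul]
  refine (Real.norm_exp_I_mul_ofReal_sub_one_le).trans ?_
  rw [norm_mul, norm_mul, Real.norm_of_nonneg Real.pi_pos.le, Real.norm_of_nonneg (by norm_num : (0:ℝ) ≤ 2),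
    mul_assoc (2 * Real.pi)]
  gcongr
  exact norm_inner_le_norm _ _

theorem fourierInv_eq_integral_planeWave (f : Eucl d → ℂ) (x : Eucl d) :
    𝓕⁻ f x = ∫ v, planeWave v x * f v := by
  rw [Real.fourierInv_eq]; rfl

end FourierLOneLTwo

/-! ### Trial functions of small kinetic energy. -/

section TrialFunctions

open Filter Topology

variable {d : ℕ} {T V : Eucl d → ℝ}

/-- An element of `L²` with prescribed integrable Fourier transform. -/
theorem exists_fourier_eq {u : Eucl d → ℂ} (hu : Integrable u volume) (hu2 : MemLp u 2 volume) :
    ∃ f : LTwo d, (𝓕 f : LTwo d) =ᵐ[volume] u ∧ f =ᵐ[volume] 𝓕⁻ u := by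
  refine ⟨(𝓕⁻ hu2.toLp : LTwo d), ?_, ?_⟩
  · have : (𝓕 (𝓕⁻ hu2.toLp : LTwo d) : LTwo d) = hu2.toLp := fourier_fourierInv_eq _
    rw [this]; exact hu2.coeFn_toLp
  · refine (coeFn_fourierInv_of_integrable _ (hu.congr hu2.coeFn_toLp.symm)).trans
      (.of_forall fun x => ?_)
    rw [fourierInv_eq_integral_planeWave, fourierInv_eq_integral_planeWave]
    refine integral_congr_ae ?_
    filter_upwards [hu2.coeFn_toLp] with v hv
    rw [hv]

/-- `1/T` is not integrable on any ball around the momentum `2πξ₀`. -/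
def IsCritical (T : Eucl d → ℝ) (ξ₀ : Eucl d) : Prop :=
  ∀ r : ℝ, 0 < r →
    ∫⁻ ξ in Metric.ball ξ₀ r, (ENNReal.ofReal (T ((2 * Real.pi) • ξ)))⁻¹ = ⊤

/-- Take u = w/I with w = (T + δ)⁻¹ on the ball and I = ∫w. By monotone convergence I exceeds 1/ε
for small δ, and since Tw ≤ 1 there, Tu² ≤ u/I ≤ εu. -/
theorem exists_weight (hT : Measurable T) (hT0 : ∀ η, 0 ≤ T η) {ξ₀ : Eucl d}
    (hc : IsCritical T ξ₀) {r ε : ℝ} (hr : 0 < r) (hε : 0 < ε) :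
    ∃ u : Eucl d → ℝ, Measurable u ∧ (∀ ξ, 0 ≤ u ξ) ∧ (∀ ξ, ξ ∉ Metric.ball ξ₀ r → u ξ = 0) ∧
      (∃ M, ∀ ξ, u ξ ≤ M) ∧ (∫ ξ, u ξ) = 1 ∧
      ∀ ξ, T ((2 * Real.pi) • ξ) * u ξ ^ 2 ≤ ε * u ξ := by
  set S : Eucl d → ℝ := fun ξ => T ((2 * Real.pi) • ξ) with hS
  have hSm : Measurable S := measurable_scaled hT
  have hS0 : ∀ ξ, 0 ≤ S ξ := fun ξ => hT0 _
  set w : ℕ → Eucl d → ℝ := fun k ξ => (S ξ + 1 / ((k : ℝ) + 1))⁻¹ with hw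
  have hwm : ∀ k, Measurable (w k) := fun k => (hSm.add_const _).inv
  have hδ : ∀ k : ℕ, 0 < 1 / ((k : ℝ) + 1) := fun k => Nat.one_div_pos_of_nat
  have hw0 : ∀ k ξ, 0 < w k ξ := fun k ξ => inv_pos.2 (by linarith [hδ k, hS0 ξ])
  have hwb : ∀ k ξ, w k ξ ≤ (k : ℝ) + 1 := by
    intro k ξ
    rw [hw]
    calc (S ξ + 1 / ((k : ℝ) + 1))⁻¹ ≤ (1 / ((k : ℝ) + 1))⁻¹ :=
          inv_anti₀ (hδ k) (by linarith [hS0 ξ])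
      _ = _ := by simp
  have hlim : Tendsto (fun k => ∫⁻ ξ in Metric.ball ξ₀ r, ENNReal.ofReal (w k ξ)) atTop
      (𝓝 (∫⁻ ξ in Metric.ball ξ₀ r, (ENNReal.ofReal (S ξ))⁻¹)) := by
    refine lintegral_tendsto_of_tendsto_of_monotone
      (fun k => (hwm k).ennreal_ofReal.aemeasurable) ?_ ?_
    · refine .of_forall fun ξ k l hkl => ENNReal.ofReal_le_ofReal ?_
      exact inv_anti₀ (by linarith [hδ l, hS0 ξ])
        (by linarith [Nat.one_div_le_one_div (α := ℝ) hkl])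
    · refine .of_forall fun ξ => ?_
      have h1 : ∀ k, ENNReal.ofReal (w k ξ) = (ENNReal.ofReal (S ξ + 1 / ((k : ℝ) + 1)))⁻¹ :=
        fun k => ENNReal.ofReal_inv_of_pos (by linarith [hδ k, hS0 ξ])
      simp only [h1]
      refine tendsto_inv_iff.2 (ENNReal.tendsto_ofReal ?_)
      simpa using (tendsto_one_div_add_atTop_nhds_zero_nat (𝕜 := ℝ)).const_add (S ξ)
  rw [hc r hr] at hlim
  obtain ⟨k, hk⟩ := (hlim.eventually (lt_mem_nhds (ENNReal.ofReal_lt_top (r := 1 / ε)))).exists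
  have hfin : volume (Metric.ball ξ₀ r) < ⊤ := measure_ball_lt_top
  have hint : IntegrableOn (w k) (Metric.ball ξ₀ r) volume := by
    refine Measure.integrableOn_of_bounded (M := (k : ℝ) + 1) hfin.ne
      (hwm k).aestronglyMeasurable (.of_forall fun ξ => ?_)
    rw [Real.norm_of_nonneg (hw0 k ξ).le]; exact hwb k ξ
  set I := ∫ ξ in Metric.ball ξ₀ r, w k ξ with hI
  have hIε : 1 / ε < I := by
    rw [← ofReal_integral_eq_lintegral_ofReal hint (.of_forall fun ξ => (hw0 k ξ).le)] at hk
    exact (ENNReal.ofReal_lt_ofReal_iff_of_nonneg (by positivity)).1 hk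
  have hI0 : 0 < I := lt_trans (by positivity) hIε
  refine ⟨(Metric.ball ξ₀ r).indicator fun ξ => w k ξ / I,
    ((hwm k).div_const I).indicator measurableSet_ball, ?_, ?_, ⟨((k : ℝ) + 1) / I, ?_⟩, ?_, ?_⟩
  · exact fun ξ => Set.indicator_nonneg (fun ξ _ => (div_pos (hw0 k ξ) hI0).le) ξ
  · exact fun ξ hξ => Set.indicator_of_notMem hξ _
  · intro ξ
    refine Set.indicator_le' (f := fun ξ => w k ξ / I) (g := fun _ => ((k : ℝ) + 1) / I) ?_ ?_ ξ
    · intro ξ _; have := hwb k ξ; gcongr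
    · intro ξ _; positivity
  · rw [integral_indicator measurableSet_ball, integral_div, div_self hI0.ne']
  · intro ξ
    by_cases hξ : ξ ∈ Metric.ball ξ₀ r
    · rw [Set.indicator_of_mem hξ]
      have h1 : S ξ * w k ξ ≤ 1 := by
        rw [hw]
        simp only
        rw [← div_eq_mul_inv, div_le_one (by linarith [hδ k, hS0 ξ])]
        linarith [hδ k]
      have h2 : 1 / I ≤ ε := by
        rw [div_le_iff₀ hI0]; rw [div_lt_iff₀ hε] at hIε; linarith
      calc S ξ * (w k ξ / I) ^ 2 = (S ξ * w k ξ) * (1 / I) * (w k ξ / I) := by ring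
        _ ≤ 1 * ε * (w k ξ / I) := by
          have := hw0 k ξ
          gcongr
        _ = _ := by ring
    · rw [Set.indicator_of_notMem hξ]; simp

/-- Trial functions close to a plane wave with small kinetic energy. -/
theorem exists_trial (hT : Measurable T) (hT0 : ∀ η, 0 ≤ T η) {ξ₀ : Eucl d}
    (hc : IsCritical T ξ₀) {ε : ℝ} (hε : 0 < ε) :
    ∃ f ∈ formDomain T, (∫ ξ, T ((2 * Real.pi) • ξ) * ‖(𝓕 f : LTwo d) ξ‖ ^ 2) ≤ ε ∧
      ∀ᵐ x, ‖f x‖ ≤ 1 ∧ ‖f x - planeWave ξ₀ x‖ ≤ ε * ‖x‖ := by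
  -- Plane waves with frequencies at distance below ε/(2π) differ at x by at most ε‖x‖.
  obtain ⟨u, hum, hu0, hur, ⟨M, huM⟩, hu1, huT⟩ := exists_weight hT hT0 hc
    (r := ε / (2 * Real.pi)) (by positivity) hε
  have hui : Integrable u volume := by
    by_contra h
    rw [integral_undef h] at hu1
    exact zero_ne_one hu1
  have huc : Integrable (fun ξ => (u ξ : ℂ)) volume := hui.ofReal
  have huc2 : MemLp (fun ξ => (u ξ : ℂ)) 2 volume := by
    rw [memLp_two_iff_integrable_sq_norm huc.1]
    refine (hui.const_mul M).mono' (huc.1.norm.pow 2) (.of_forall fun ξ => ?_)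
    rw [norm_pow, norm_norm, Complex.norm_real, Real.norm_of_nonneg (hu0 ξ), sq]
    exact mul_le_mul_of_nonneg_right (huM ξ) (hu0 ξ)
  obtain ⟨f, hf1, hf2⟩ := exists_fourier_eq huc huc2
  have hkin : (fun ξ => T ((2 * Real.pi) • ξ) * ‖(𝓕 f : LTwo d) ξ‖ ^ 2) =ᵐ[volume]
      fun ξ => T ((2 * Real.pi) • ξ) * u ξ ^ 2 := by
    filter_upwards [hf1] with ξ hξ
    rw [hξ, Complex.norm_real, Real.norm_eq_abs, sq_abs]
  have hkin2 : Integrable (fun ξ => T ((2 * Real.pi) • ξ) * u ξ ^ 2) volume := by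
    refine (hui.const_mul ε).mono' ((measurable_scaled hT).mul (hum.pow_const 2)).aestronglyMeasurable
      (.of_forall fun ξ => ?_)
    rw [Real.norm_of_nonneg (mul_nonneg (hT0 _) (sq_nonneg _))]
    exact huT ξ
  refine ⟨f, hkin2.congr hkin.symm, ?_, ?_⟩
  · rw [integral_congr_ae hkin]
    refine (integral_mono hkin2 (hui.const_mul ε) huT).trans ?_
    rw [integral_const_mul, hu1, mul_one]
  · filter_upwards [hf2] with x hx
    rw [hx]
    have hn : ∀ ξ, ‖(u ξ : ℂ)‖ = u ξ := fun ξ => by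
      rw [Complex.norm_real, Real.norm_of_nonneg (hu0 ξ)]
    constructor
    · refine (norm_fourierInv_le _ _).trans ?_
      simp only [hn, hu1, le_refl]
    · have hpi : Integrable (fun ξ => planeWave ξ x * (u ξ : ℂ)) volume := by
        refine huc.bdd_mul (c := 1) ?_ (.of_forall fun ξ => (norm_planeWave ξ x).le)
        exact (continuous_planeWave.comp (by fun_prop : Continuous fun ξ : Eucl d => (ξ, x))).aestronglyMeasurable
      have h1 : planeWave ξ₀ x = ∫ ξ, planeWave ξ₀ x * (u ξ : ℂ) := by
        rw [integral_const_mul, integral_complex_ofReal, hu1]; simp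
      rw [fourierInv_eq_integral_planeWave]
      conv_lhs => rw [h1]
      rw [← integral_sub hpi (huc.const_mul _)]
      refine (norm_integral_le_integral_norm _).trans ?_
      calc _ ≤ ∫ ξ, ε * ‖x‖ * u ξ := by
            refine integral_mono (hpi.sub (huc.const_mul _)).norm (hui.const_mul _) fun ξ => ?_
            simp only
            rw [← sub_mul, norm_mul, hn]
            by_cases hξ : ξ ∈ Metric.ball ξ₀ (ε / (2 * Real.pi))
            · refine mul_le_mul_of_nonneg_right ?_ (hu0 ξ)
              refine (norm_planeWave_sub_le _ _ _).trans ?_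
              refine mul_le_mul_of_nonneg_right ?_ (norm_nonneg _)
              rw [Metric.mem_ball, dist_eq_norm, lt_div_iff₀ (by positivity)] at hξ
              linarith
            · rw [hur ξ hξ]; simp
        _ = _ := by rw [integral_const_mul, hu1, mul_one]

end TrialFunctions

/-! ### One negative energy when V is integrable. -/

section SingleEigenvalue

open Filter Topology

variable {d : ℕ} {T V : Eucl d → ℝ}

/-- A bounded function in the form domain which detects `V` against a plane wave. -/
theorem exists_test_function (hT : Measurable T) (hT0 : ∀ η, 0 ≤ T η)
    (hVi : Integrable V volume) (hV0 : ¬ V =ᵐ[volume] 0) (ξ₀ : Eucl d) :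
    ∃ g ∈ formDomain T, (∃ M, ∀ᵐ x, ‖g x‖ ≤ M) ∧
      ∫ x, (V x : ℂ) * (conj (planeWave ξ₀ x) * g x) ≠ 0 := by
  set W : Eucl d → ℂ := fun x => (V x : ℂ) * conj (planeWave ξ₀ x) with hW
  have hpw : AEStronglyMeasurable (fun x => conj (planeWave ξ₀ x)) volume :=
    (Complex.continuous_conj.comp (continuous_planeWave.comp
      (by fun_prop : Continuous fun x : Eucl d => (ξ₀, x)))).aestronglyMeasurable
  have hpn : ∀ x, ‖conj (planeWave ξ₀ x)‖ = 1 := fun x => by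
    rw [RCLike.norm_conj, norm_planeWave]
  have hWi : Integrable W volume :=
    (hVi.ofReal (𝕜 := ℂ)).mul_bdd (c := 1) hpw (.of_forall fun x => (hpn x).le)
  set h : Eucl d → ℂ := 𝓕⁻ W with hh
  have hhc : Continuous h := continuous_fourierInv hWi
  set A := ∫ v, ‖W v‖ with hA
  have hA0 : 0 ≤ A := integral_nonneg fun _ => norm_nonneg _
  have hhb : ∀ x, ‖h x‖ ≤ A := norm_fourierInv_le W
  -- The test function has Fourier transform conj h on some S n, so its pairing with W is ∫|h|² over
  -- S n. This is nonzero for some n, as W is not a.e. zero. Boundedness of S n and of T on it puts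
  -- the function in the form domain.
  set S : ℕ → Set (Eucl d) := fun n => Metric.ball 0 n ∩ {ξ | T ((2 * Real.pi) • ξ) ≤ n} with hS
  have hSm : ∀ n, MeasurableSet (S n) := fun n =>
    measurableSet_ball.inter (measurableSet_le (measurable_scaled hT) measurable_const)
  have hSf : ∀ n, volume (S n) < ⊤ := fun n =>
    lt_of_le_of_lt (measure_mono Set.inter_subset_left) measure_ball_lt_top
  have hex : ∃ n, ∫ ξ in S n, ‖h ξ‖ ^ 2 ≠ 0 := by
    by_contra! hcon
    refine hV0 ?_
    have hz : h =ᵐ[volume] 0 := by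
      have : ∀ n, ∀ᵐ ξ, ξ ∈ S n → h ξ = 0 := by
        intro n
        have hi : IntegrableOn (fun ξ => ‖h ξ‖ ^ 2) (S n) volume := by
          refine Measure.integrableOn_of_bounded (M := A ^ 2) (hSf n).ne
            (hhc.norm.pow 2).aestronglyMeasurable (.of_forall fun ξ => ?_)
          rw [norm_pow, norm_norm]
          gcongr
          exact hhb ξ
        have := (setIntegral_eq_zero_iff_of_nonneg_ae (.of_forall fun ξ => by positivity) hi).1
          (hcon n)
        rw [EventuallyEq, ae_restrict_iff' (hSm n)] at this
        filter_upwards [this] with ξ hξ hmem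
        simpa using hξ hmem
      filter_upwards [ae_all_iff.2 this] with ξ hξ
      obtain ⟨n, hn⟩ := exists_nat_gt (max ‖ξ‖ (T ((2 * Real.pi) • ξ)))
      refine hξ n ⟨?_, ?_⟩
      · rw [mem_ball_zero_iff]; exact lt_of_le_of_lt (le_max_left _ _) hn
      · exact (lt_of_le_of_lt (le_max_right _ _) hn).le
    filter_upwards [ae_eq_zero_of_fourierInv_ae_eq_zero hWi hz] with x hx
    have h1 : planeWave ξ₀ x ≠ 0 := by
      rw [← norm_ne_zero_iff, norm_planeWave]; exact one_ne_zero
    simpa [hW, h1] using hx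
  obtain ⟨n, hn⟩ := hex
  set u : Eucl d → ℂ := (S n).indicator fun ξ => conj (h ξ) with hu
  have hum : AEStronglyMeasurable u volume :=
    (Complex.continuous_conj.comp hhc).aestronglyMeasurable.indicator (hSm n)
  have hub : ∀ ξ, ‖u ξ‖ ≤ A := by
    intro ξ
    refine (norm_indicator_le_norm_self _ _).trans ?_
    rw [RCLike.norm_conj]; exact hhb ξ
  have hui : Integrable u volume := by
    rw [hu, integrable_indicator_iff (hSm n)]
    refine Measure.integrableOn_of_bounded (M := A) (hSf n).ne
      (Complex.continuous_conj.comp hhc).aestronglyMeasurable (.of_forall fun ξ => ?_)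
    rw [RCLike.norm_conj]; exact hhb ξ
  have husq : Integrable (fun ξ => ‖u ξ‖ ^ 2) volume := by
    refine (hui.norm.const_mul A).mono' (hum.norm.pow 2) (.of_forall fun ξ => ?_)
    rw [norm_pow, norm_norm, sq]
    exact mul_le_mul_of_nonneg_right (hub ξ) (norm_nonneg _)
  obtain ⟨g, hg1, hg2⟩ := exists_fourier_eq hui ((memLp_two_iff_integrable_sq_norm hum).2 husq)
  refine ⟨g, ?_, ⟨∫ v, ‖u v‖, ?_⟩, ?_⟩
  · refine (husq.const_mul (n : ℝ)).mono' ((measurable_scaled hT).aestronglyMeasurable.mul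
      ((Lp.aestronglyMeasurable _).norm.pow 2)) ?_
    filter_upwards [hg1] with ξ hξ
    rw [hξ, Real.norm_of_nonneg (mul_nonneg (hT0 _) (sq_nonneg _))]
    by_cases hmem : ξ ∈ S n
    · exact mul_le_mul_of_nonneg_right hmem.2 (sq_nonneg _)
    · rw [hu, Set.indicator_of_notMem hmem]; simp
  · filter_upwards [hg2] with x hx
    rw [hx]; exact norm_fourierInv_le u x
  · have h1 : ∫ x, (V x : ℂ) * (conj (planeWave ξ₀ x) * g x) = ∫ ξ in S n, ((‖h ξ‖ ^ 2 : ℝ) : ℂ) := by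
      calc _ = ∫ x, W x * 𝓕⁻ u x := by
            refine integral_congr_ae ?_
            filter_upwards [hg2] with x hx
            rw [hx, hW]; ring
        _ = ∫ ξ, h ξ * u ξ := (integral_fourierInv_mul W u hWi hui).symm
        _ = ∫ ξ, (S n).indicator (fun ξ => ((‖h ξ‖ ^ 2 : ℝ) : ℂ)) ξ := by
            refine integral_congr_ae (.of_forall fun ξ => ?_)
            by_cases hmem : ξ ∈ S n
            · simp only [hu, Set.indicator_of_mem hmem]
              rw [Complex.mul_conj, Complex.normSq_eq_norm_sq]
            · simp [hu, Set.indicator_of_notMem hmem]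
        _ = _ := integral_indicator (hSm n)
    rw [h1, integral_complex_ofReal]
    exact_mod_cast hn

/-- Weighted Young inequality. With t the square root of the kinetic energy bound for f, the cross
term with a fixed g vanishes in the limit. -/
theorem norm_kinetic_le (hT0 : ∀ η, 0 ≤ T η) {f g : LTwo d}
    (hf : f ∈ formDomain T) (hg : g ∈ formDomain T) {t : ℝ} (ht : 0 < t) :
    ‖∫ ξ, (T ((2 * Real.pi) • ξ) : ℂ) * (conj ((𝓕 f : LTwo d) ξ) * (𝓕 g : LTwo d) ξ)‖ ≤
      t⁻¹ * (∫ ξ, T ((2 * Real.pi) • ξ) * ‖(𝓕 f : LTwo d) ξ‖ ^ 2) +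
        t * ∫ ξ, T ((2 * Real.pi) • ξ) * ‖(𝓕 g : LTwo d) ξ‖ ^ 2 := by
  rw [← integral_const_mul, ← integral_const_mul,
    ← integral_add (Integrable.const_mul hf _) (Integrable.const_mul hg _)]
  refine norm_integral_le_of_norm_le
    ((Integrable.const_mul hf _).add (Integrable.const_mul hg _)) (.of_forall fun ξ => ?_)
  rw [norm_mul, norm_mul, RCLike.norm_conj, Complex.norm_real, Real.norm_of_nonneg (hT0 _)]
  set a := ‖(𝓕 f : LTwo d) ξ‖
  set b := ‖(𝓕 g : LTwo d) ξ‖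
  have h1 : a * b ≤ t⁻¹ * a ^ 2 + t * b ^ 2 := by
    have h2 : t⁻¹ * a ^ 2 + t * b ^ 2 - 2 * (a * b) = t⁻¹ * (a - t * b) ^ 2 := by
      field_simp; ring
    have h3 : 0 ≤ t⁻¹ * (a - t * b) ^ 2 := by positivity
    have h4 : 0 ≤ a * b := by positivity
    linarith
  calc _ ≤ T ((2 * Real.pi) • ξ) * (t⁻¹ * a ^ 2 + t * b ^ 2) :=
        mul_le_mul_of_nonneg_left h1 (hT0 _)
    _ = _ := by ring

/-- Along trial functions f k, the energy of f k + c g tends to ∫V + 2 Re(cz) + |c|²q, where z ≠ 0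
is the V-coupling of g to the plane wave and q the energy of g. The term linear in c wins for small
c of the right phase. -/
theorem exists_negative_energy (hT : Measurable T) (hT0 : ∀ η, 0 ≤ T η)
    (hV : AEMeasurable V volume) (hTV : IsRelFormCompact T V) (hVi : Integrable V volume)
    (hV0 : ¬ V =ᵐ[volume] 0) (hneg : (∫ x, V x) ≤ 0) {ξ₀ : Eucl d} (hc : IsCritical T ξ₀) :
    ∃ f ∈ formDomain T, (energyForm T V f f).re < 0 := by
  obtain ⟨g, hg, ⟨M, hM⟩, hz⟩ := exists_test_function hT hT0 hVi hV0 ξ₀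
  set z := ∫ x, (V x : ℂ) * (conj (planeWave ξ₀ x) * g x) with hzdef
  have hε : ∀ k : ℕ, 0 < 1 / ((k : ℝ) + 1) := fun k => Nat.one_div_pos_of_nat
  choose f hfD hfk hfx using fun k : ℕ => exists_trial hT hT0 hc (hε k)
  set Q := ∫ ξ, T ((2 * Real.pi) • ξ) * ‖(𝓕 g : LTwo d) ξ‖ ^ 2 with hQ
  have h0 : Tendsto (fun k : ℕ => 1 / ((k : ℝ) + 1)) atTop (𝓝 0) :=
    tendsto_one_div_add_atTop_nhds_zero_nat
  have hall : ∀ᵐ x, ∀ k, ‖f k x‖ ≤ 1 ∧ ‖f k x - planeWave ξ₀ x‖ ≤ 1 / ((k : ℝ) + 1) * ‖x‖ :=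
    ae_all_iff.2 hfx
  have hfx' : ∀ᵐ x, Tendsto (fun k => f k x) atTop (𝓝 (planeWave ξ₀ x)) := by
    filter_upwards [hall] with x hx
    rw [tendsto_iff_norm_sub_tendsto_zero]
    refine squeeze_zero (fun _ => norm_nonneg _) (fun k => (hx k).2) ?_
    simpa using h0.mul_const ‖x‖
  have hkin0 : ∀ k, 0 ≤ ∫ ξ, T ((2 * Real.pi) • ξ) * ‖(𝓕 (f k) : LTwo d) ξ‖ ^ 2 := fun k =>
    integral_nonneg fun ξ => mul_nonneg (hT0 _) (sq_nonneg _)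
  have hdiag : Tendsto (fun k => (energyForm T V (f k) (f k)).re) atTop (𝓝 (∫ x, V x)) := by
    simp only [re_energyForm_self]
    rw [← zero_add (∫ x, V x)]
    refine Tendsto.add (squeeze_zero hkin0 hfk h0) ?_
    refine tendsto_integral_of_dominated_convergence (fun x => ‖V x‖)
      (fun k => hV.aestronglyMeasurable.mul ((Lp.aestronglyMeasurable _).norm.pow 2))
      hVi.norm (fun k => ?_) ?_
    · filter_upwards [hall] with x hx
      rw [norm_mul, norm_pow, norm_norm]
      exact mul_le_of_le_one_right (norm_nonneg _) (pow_le_one₀ (norm_nonneg _) (hx k).1)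
    · filter_upwards [hfx'] with x hx
      have := ((hx.norm).pow 2).const_mul (V x)
      simpa [norm_planeWave] using this
  have hoff : Tendsto (fun k => energyForm T V (f k) g) atTop (𝓝 z) := by
    simp only [energyForm]
    rw [← zero_add z]
    refine Tendsto.add ?_ ?_
    · refine squeeze_zero_norm (a := fun k : ℕ => √(1 / ((k : ℝ) + 1)) * (1 + Q)) (fun k => ?_) ?_
      · have h1 := norm_kinetic_le hT0 (hfD k) hg (Real.sqrt_pos.2 (hε k))
        refine h1.trans ?_
        have h2 : (√(1 / ((k : ℝ) + 1)))⁻¹ *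
            (∫ ξ, T ((2 * Real.pi) • ξ) * ‖(𝓕 (f k) : LTwo d) ξ‖ ^ 2) ≤ √(1 / ((k : ℝ) + 1)) := by
          rw [inv_mul_le_iff₀ (Real.sqrt_pos.2 (hε k)), Real.mul_self_sqrt (hε k).le]
          exact hfk k
        linarith
      · have := ((Real.continuous_sqrt.tendsto 0).comp h0).mul_const (1 + Q)
        simpa using this
    · refine tendsto_integral_of_dominated_convergence (fun x => ‖V x‖ * M)
        (fun k => (Complex.measurable_ofReal.comp_aemeasurable hV).aestronglyMeasurable.mul
          ((Complex.continuous_conj.comp_aestronglyMeasurable (Lp.aestronglyMeasurable _)).mul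
            (Lp.aestronglyMeasurable _))) (hVi.norm.mul_const M) (fun k => ?_) ?_
      · filter_upwards [hall, hM] with x hx hMx
        rw [norm_mul, norm_mul, RCLike.norm_conj, Complex.norm_real]
        refine mul_le_mul_of_nonneg_left ?_ (norm_nonneg _)
        exact (mul_le_of_le_one_left (norm_nonneg _) (hx k).1).trans hMx
      · filter_upwards [hfx'] with x hx
        exact (((Complex.continuous_conj.tendsto _).comp hx).mul_const _).const_mul _
  set q := (energyForm T V g g).re with hq
  -- Since tq ≤ 1, the choice c = -t z̄ brings the limit down to at most ∫V - t|z|² < 0.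
  set t : ℝ := 1 / (|q| + 1) with ht
  have ht0 : 0 < t := by positivity
  have htq : t * q ≤ 1 := by
    rw [ht, one_div, inv_mul_le_iff₀ (by positivity)]; linarith [le_abs_self q]
  set c : ℂ := -(t : ℂ) * conj z with hcdef
  have hzpos : 0 < ‖z‖ ^ 2 := by positivity
  have hlim : Tendsto (fun k => (energyForm T V (f k + c • g) (f k + c • g)).re) atTop
      (𝓝 ((∫ x, V x) + 2 * (c * z).re + ‖c‖ ^ 2 * q)) := by
    simp only [fun k => energyForm_add_smul hT hT0 hV hTV (hfD k) hg c]
    exact (hdiag.add (((Complex.continuous_re.tendsto _).comp (hoff.const_mul c)).const_mul 2)).add_const _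
  have e1 : (c * z).re = -t * ‖z‖ ^ 2 := by
    rw [hcdef, mul_assoc, mul_comm (conj z), Complex.mul_conj, Complex.normSq_eq_norm_sq]
    norm_cast
  have e2 : ‖c‖ ^ 2 = t ^ 2 * ‖z‖ ^ 2 := by
    simp [hcdef, mul_pow]
  have hlt : (∫ x, V x) + 2 * (c * z).re + ‖c‖ ^ 2 * q < 0 := by
    rw [e1, e2]
    have h1 : t ^ 2 * ‖z‖ ^ 2 * q = (t * q) * (t * ‖z‖ ^ 2) := by ring
    have h2 : 0 < t * ‖z‖ ^ 2 := by positivity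
    rw [h1]
    nlinarith
  obtain ⟨k, hk⟩ := (hlim.eventually (gt_mem_nhds hlt)).exists
  exact ⟨_, add_mem_formDomain hT hT0 (hfD k) (smul_mem_formDomain hT hT0 c hg), hk⟩

end SingleEigenvalue

/-! ### Independence of plane waves on sets of positive measure. -/

section PlaneWaves

open Filter Topology

variable {d : ℕ}

/-- Translation is continuous in measure. For F ⊆ E of finite positive measure, a null overlap would
put almost all of F in its symmetric difference with a translate, whose measure tends to 0. -/
theorem exists_translate_inter_pos {E : Set (Eucl d)} (hE : MeasurableSet E)
    (hpos : 0 < volume E) : ∀ᶠ h in 𝓝 (0 : Eucl d), 0 < volume (E ∩ (fun x => x + h) ⁻¹' E) := by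
  obtain ⟨F, hFm, hFE, hF0, hFt⟩ := Measure.exists_subset_measure_lt_top hE hpos
  let g : C(Eucl d × Eucl d, Eucl d) := ⟨fun p => p.2 + p.1, by fun_prop⟩
  have hg : Tendsto (fun h => g.curry h) (𝓝 0) (𝓝 (g.curry 0)) := g.curry.continuous.tendsto 0
  have hmp : ∀ h, MeasurePreserving (g.curry h) volume volume := fun h =>
    measurePreserving_add_right volume h
  have key := tendsto_measure_symmDiff_preimage_nhds_zero (μ := volume) (ν := volume) hg
    (.of_forall hmp) (hmp 0) hFm.nullMeasurableSet hFt.ne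
  have h0 : (g.curry 0 : Eucl d → Eucl d) ⁻¹' F = F := by
    ext x; simp [g]
  rw [h0] at key
  filter_upwards [key.eventually (gt_mem_nhds hF0)] with h hh
  have hsub : F ⊆ (F ∩ (g.curry h) ⁻¹' F) ∪ symmDiff ((g.curry h) ⁻¹' F) F := by
    intro x hx
    by_cases hx' : x ∈ (g.curry h) ⁻¹' F
    · exact Or.inl ⟨hx, hx'⟩
    · exact Or.inr (Or.inr ⟨hx, hx'⟩)
  have h1 : 0 < volume (F ∩ (g.curry h) ⁻¹' F) := by
    by_contra hcon
    have hz : volume (F ∩ (g.curry h) ⁻¹' F) = 0 := by simpa using hcon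
    have := (measure_mono hsub).trans (measure_union_le (μ := volume) _ _)
    rw [hz, zero_add] at this
    exact absurd hh (not_lt.2 this)
  exact h1.trans_le (measure_mono (Set.inter_subset_inter hFE (Set.preimage_mono hFE)))

theorem planeWave_add (ξ x h : Eucl d) : planeWave ξ (x + h) = planeWave ξ x * planeWave ξ h := by
  simp only [planeWave_eq_exp, ← Complex.exp_add, inner_add_right]
  congr 1
  push_cast; ring

theorem planeWave_ne_zero (ξ x : Eucl d) : planeWave ξ x ≠ 0 := by
  rw [← norm_ne_zero_iff, norm_planeWave]; exact one_ne_zero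

/-- Along b - a the phases differ by 2πs‖b - a‖², which lies strictly between 0 and 2π for small s >
0. -/
theorem eventually_planeWave_ne {a b : Eucl d} (hab : a ≠ b) :
    ∀ᶠ s : ℝ in 𝓝[>] 0, planeWave b (s • (b - a)) ≠ planeWave a (s • (b - a)) := by
  have hn : 0 < ‖b - a‖ ^ 2 := by
    have : 0 < ‖b - a‖ := norm_pos_iff.2 (sub_ne_zero.2 hab.symm)
    positivity
  have h1 : ∀ᶠ s : ℝ in 𝓝[>] 0, s < 1 / ‖b - a‖ ^ 2 :=
    nhdsWithin_le_nhds (gt_mem_nhds (by positivity))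
  filter_upwards [h1, self_mem_nhdsWithin] with s hs hs0 heq
  rw [lt_div_iff₀ hn] at hs
  have hs0' : 0 < s * ‖b - a‖ ^ 2 := mul_pos hs0 hn
  rw [planeWave_eq_exp, planeWave_eq_exp, Complex.exp_eq_exp_iff_exists_int] at heq
  obtain ⟨n, hn'⟩ := heq
  have h2 : (2 * Real.pi * inner ℝ b (s • (b - a)) : ℝ) =
      2 * Real.pi * inner ℝ a (s • (b - a)) + n * (2 * Real.pi) := by
    have h3 : Complex.I * ((2 * Real.pi * inner ℝ b (s • (b - a)) : ℝ) : ℂ) =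
        Complex.I * ((2 * Real.pi * inner ℝ a (s • (b - a)) + n * (2 * Real.pi) : ℝ) : ℂ) := by
      rw [hn']; push_cast; ring
    exact_mod_cast mul_left_cancel₀ Complex.I_ne_zero h3
  have h4 : inner ℝ b (s • (b - a)) - inner ℝ a (s • (b - a)) = s * ‖b - a‖ ^ 2 := by
    rw [← inner_sub_left, inner_smul_right, real_inner_self_eq_norm_sq]
  have h5 : s * ‖b - a‖ ^ 2 = n := by
    rw [← h4]
    have := Real.pi_pos
    have h6 : (2 * Real.pi) * (inner ℝ b (s • (b - a)) - inner ℝ a (s • (b - a))) =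
      (2 * Real.pi) * n := by linarith
    exact mul_left_cancel₀ (by positivity) h6
  rw [h5] at hs hs0'
  have h7 : (0 : ℤ) < n := by exact_mod_cast hs0'
  have h8 : n < (1 : ℤ) := by exact_mod_cast hs
  omega

/-- Plane waves are linearly independent on every set of positive measure. -/
theorem planeWave_coeff_eq_zero (s : Finset (Eucl d)) : ∀ E : Set (Eucl d), MeasurableSet E →
    0 < volume E → ∀ c : Eucl d → ℂ, (∀ x ∈ E, ∑ ξ ∈ s, c ξ * planeWave ξ x = 0) →
    ∀ ξ ∈ s, c ξ = 0 := by
  induction s using Finset.induction_on with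
  | empty => simp
  | insert a s ha ih =>
    intro E hE hpos c hc
    have hs : ∀ b ∈ s, c b = 0 := by
      intro b hb
      have hab : a ≠ b := fun h => ha (h ▸ hb)
      have ht : Tendsto (fun t : ℝ => t • (b - a)) (𝓝[>] 0) (𝓝 0) := by
        have : Continuous fun t : ℝ => t • (b - a) := by fun_prop
        simpa using (this.tendsto 0).mono_left nhdsWithin_le_nhds
      obtain ⟨t, ht1, ht2⟩ := ((ht.eventually (exists_translate_inter_pos hE hpos)).and
        (eventually_planeWave_ne hab)).exists
      set h := t • (b - a)
      have hE' : MeasurableSet (E ∩ (fun x => x + h) ⁻¹' E) :=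
        hE.inter ((measurable_add_const h) hE)
      -- Subtracting the phase of a at h times the relation at x from the relation at x + h
      -- eliminates the frequency a and multiplies the coefficient at each other frequency by a
      -- phase difference, nonzero at b.
      have := ih _ hE' ht1 (fun ξ => c ξ * (planeWave ξ h - planeWave a h)) (fun x hx => by
        have h1 := hc x hx.1
        have h2 := hc (x + h) hx.2
        rw [Finset.sum_insert ha] at h1 h2
        simp only [planeWave_add] at h2
        have h3 : ∑ ξ ∈ s, c ξ * (planeWave ξ h - planeWave a h) * planeWave ξ x =
            ∑ ξ ∈ s, c ξ * (planeWave ξ x * planeWave ξ h) -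
              planeWave a h * ∑ ξ ∈ s, c ξ * planeWave ξ x := by
          rw [Finset.mul_sum, ← Finset.sum_sub_distrib]
          exact Finset.sum_congr rfl fun ξ _ => by ring
        rw [h3]
        linear_combination h2 - planeWave a h * h1) b hb
      exact (mul_eq_zero.1 this).resolve_right (sub_ne_zero.2 ht2)
    intro ξ hξ
    rcases Finset.mem_insert.1 hξ with rfl | hξ
    · obtain ⟨x, hx⟩ : E.Nonempty := nonempty_of_measure_ne_zero hpos.ne'
      have h1 := hc x hx
      rw [Finset.sum_insert ha, Finset.sum_eq_zero (fun b hb => by rw [hs b hb, zero_mul]),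
        add_zero] at h1
      exact (mul_eq_zero.1 h1).resolve_right (planeWave_ne_zero _ _)
    · exact hs ξ hξ

theorem continuous_planeWave_right (ξ : Eucl d) : Continuous (planeWave ξ) :=
  continuous_planeWave.comp (by fun_prop : Continuous fun x : Eucl d => (ξ, x))

theorem integral_norm_sum_planeWave_pos {N : ℕ} {ξ : Fin N → Eucl d}
    (hξ : Function.Injective ξ) {E : Set (Eucl d)} (hE : MeasurableSet E) (hpos : 0 < volume E)
    (hfin : volume E < ⊤) {c : Fin N → ℂ} (hc : c ≠ 0) :
    0 < ∫ x in E, ‖∑ i, c i * planeWave (ξ i) x‖ ^ 2 := by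
  have hcont : Continuous fun x => ‖∑ i, c i * planeWave (ξ i) x‖ ^ 2 :=
    (continuous_finsetSum _ fun i _ =>
      continuous_const.mul (continuous_planeWave_right (ξ i))).norm.pow 2
  refine lt_of_le_of_ne (integral_nonneg fun x => sq_nonneg _) fun h0 => hc ?_
  have hi : IntegrableOn (fun x => ‖∑ i, c i * planeWave (ξ i) x‖ ^ 2) E volume := by
    refine Measure.integrableOn_of_bounded (M := (∑ i, ‖c i‖) ^ 2) hfin.ne
      hcont.aestronglyMeasurable (.of_forall fun x => ?_)
    rw [norm_pow, norm_norm]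
    gcongr
    refine (norm_sum_le _ _).trans (Finset.sum_le_sum fun i _ => ?_)
    rw [norm_mul, norm_planeWave, mul_one]
  have hz := (setIntegral_eq_zero_iff_of_nonneg_ae (.of_forall fun x => sq_nonneg _) hi).1 h0.symm
  rw [EventuallyEq, ae_restrict_iff' hE] at hz
  set F := E ∩ {x | ‖∑ i, c i * planeWave (ξ i) x‖ ^ 2 = 0} with hF
  have hFm : MeasurableSet F := hE.inter (hcont.measurable (measurableSet_singleton 0))
  have hFpos : 0 < volume F := by
    have : F =ᵐ[volume] E := by
      filter_upwards [hz] with x hx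
      refine propext ⟨fun h => h.1, fun h => ⟨h, hx h⟩⟩
    rwa [measure_congr this]
  funext i
  have : Nonempty (Fin N) := ⟨i⟩
  classical
  have key := planeWave_coeff_eq_zero (Finset.univ.image ξ) F hFm hFpos
    (fun η => c (Function.invFun ξ η)) (fun x hx => by
      rw [Finset.sum_image fun i _ j _ h => hξ h]
      have h1 : ‖∑ i, c i * planeWave (ξ i) x‖ ^ 2 = 0 := hx.2
      have h2 : ∑ i, c i * planeWave (ξ i) x = 0 := by simpa using h1
      simpa only [Function.leftInverse_invFun hξ _] using h2)
  have := key (ξ i) (Finset.mem_image_of_mem _ (Finset.mem_univ i))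
  simpa only [Function.leftInverse_invFun hξ i, Pi.zero_apply] using this

/-- By homogeneity κ is the minimum over the compact unit sphere, positive by linear independence.
-/
theorem exists_integral_norm_sum_planeWave_ge {N : ℕ} {ξ : Fin N → Eucl d}
    (hξ : Function.Injective ξ) {E : Set (Eucl d)} (hE : MeasurableSet E) (hpos : 0 < volume E)
    (hfin : volume E < ⊤) : ∃ κ : ℝ, 0 < κ ∧ ∀ c : Fin N → ℂ,
      κ * ‖c‖ ^ 2 ≤ ∫ x in E, ‖∑ i, c i * planeWave (ξ i) x‖ ^ 2 := by
  rcases Nat.eq_zero_or_pos N with rfl | hN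
  · refine ⟨1, one_pos, fun c => ?_⟩
    have : c = 0 := Subsingleton.elim _ _
    subst this
    simp
  have : Nonempty (Fin N) := ⟨⟨0, hN⟩⟩
  set G : (Fin N → ℂ) → ℝ := fun c => ∫ x in E, ‖∑ i, c i * planeWave (ξ i) x‖ ^ 2 with hG
  have hcont : ContinuousOn G (Metric.sphere 0 1) := by
    rw [continuousOn_iff_continuous_domRestrict]
    refine continuous_of_dominated (bound := fun _ => (N : ℝ) ^ 2) (fun c => ?_) (fun c => ?_) ?_ ?_
    · exact ((continuous_finsetSum _ fun i _ =>
        continuous_const.mul (continuous_planeWave_right (ξ i))).norm.pow 2).aestronglyMeasurable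
    · refine .of_forall fun x => ?_
      rw [norm_pow, norm_norm]
      gcongr
      refine (norm_sum_le _ _).trans ?_
      calc _ ≤ ∑ _i : Fin N, (1 : ℝ) := Finset.sum_le_sum fun i _ => by
            rw [norm_mul, norm_planeWave, mul_one]
            exact (norm_le_pi_norm (c : Fin N → ℂ) i).trans (mem_sphere_zero_iff_norm.1 c.2).le
        _ = N := by simp
    · exact integrableOn_const hfin.ne
    · refine .of_forall fun x => ?_
      exact (continuous_finsetSum _ fun i _ =>
        ((continuous_apply i).comp continuous_subtype_val).mul continuous_const).norm.pow 2
  have hne : (Metric.sphere (0 : Fin N → ℂ) 1).Nonempty := NormedSpace.sphere_nonempty.2 zero_le_one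
  obtain ⟨c₀, hc₀, hmin⟩ := (isCompact_sphere (0 : Fin N → ℂ) 1).exists_isMinOn hne hcont
  have hc₀0 : c₀ ≠ 0 := by rintro rfl; simp at hc₀
  refine ⟨G c₀, integral_norm_sum_planeWave_pos hξ hE hpos hfin hc₀0, fun c => ?_⟩
  by_cases hc : c = 0
  · subst hc; simp
  have hn : 0 < ‖c‖ := norm_pos_iff.2 hc
  set b : Fin N → ℂ := ((‖c‖⁻¹ : ℝ) : ℂ) • c with hb
  have hb1 : b ∈ Metric.sphere (0 : Fin N → ℂ) 1 := by
    rw [mem_sphere_zero_iff_norm, hb, norm_smul]; simp [hn.ne']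
  have h1 : G c₀ ≤ G b := hmin hb1
  have h2 : G b = (‖c‖⁻¹) ^ 2 * G c := by
    rw [hG]
    simp only
    rw [← integral_const_mul]
    refine integral_congr_ae (.of_forall fun x => ?_)
    simp only [hb, Pi.smul_apply, smul_eq_mul, mul_assoc]
    rw [← Finset.mul_sum, norm_mul, mul_pow, Complex.norm_real, Real.norm_of_nonneg (by positivity)]
  rw [h2] at h1
  calc G c₀ * ‖c‖ ^ 2 ≤ (‖c‖⁻¹) ^ 2 * G c * ‖c‖ ^ 2 := by gcongr
    _ = G c := by field_simp

end PlaneWaves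

/-! ### Negative subspaces of every dimension when V ≤ 0. -/

section ManyEigenvalues

open Filter Topology

variable {d : ℕ} {T V : Eucl d → ℝ}

/-- A nonpositive nonzero potential is bounded away from zero on a bounded set of positive
measure. -/
theorem exists_set_potential_le (hV : AEMeasurable V volume) (hV0 : ¬ V =ᵐ[volume] 0)
    (hneg : ∀ᵐ x ∂volume, V x ≤ 0) : ∃ (E : Set (Eucl d)) (a ρ : ℝ), MeasurableSet E ∧
      0 < volume E ∧ volume E < ⊤ ∧ 0 < a ∧ 0 < ρ ∧ (∀ x ∈ E, ‖x‖ ≤ ρ) ∧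
      ∀ᵐ x ∂volume, x ∈ E → V x ≤ -a := by
  set E : ℕ → Set (Eucl d) := fun n =>
    Metric.ball 0 (n + 1) ∩ {x | hV.mk V x ≤ -(1 / ((n : ℝ) + 1))} with hE
  have hEm : ∀ n, MeasurableSet (E n) := fun n =>
    measurableSet_ball.inter (measurableSet_le hV.measurable_mk measurable_const)
  have hex : ∃ n, 0 < volume (E n) := by
    by_contra! hcon
    have h0 : ∀ n, ∀ᵐ x, x ∉ E n := fun n =>
      measure_eq_zero_iff_ae_notMem.1 (nonpos_iff_eq_zero.1 (hcon n))
    refine hV0 ?_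
    filter_upwards [ae_all_iff.2 h0, hneg, hV.ae_eq_mk] with x hx hVx hmk
    refine le_antisymm hVx ?_
    by_contra! hlt
    rw [Pi.zero_apply] at hlt
    obtain ⟨n₁, hn₁⟩ := exists_nat_one_div_lt (show 0 < -V x by linarith)
    obtain ⟨n₂, hn₂⟩ := exists_nat_gt ‖x‖
    refine hx (max n₁ n₂) ⟨?_, ?_⟩
    · rw [mem_ball_zero_iff]
      refine hn₂.trans ?_
      push_cast
      linarith [le_max_right (n₁ : ℝ) n₂]
    · have := Nat.one_div_le_one_div (α := ℝ) (le_max_left n₁ n₂)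
      rw [Set.mem_ofPred_eq, ← hmk]
      linarith
  obtain ⟨n, hn⟩ := hex
  refine ⟨E n, 1 / ((n : ℝ) + 1), n + 1, hEm n, hn,
    (measure_mono Set.inter_subset_left).trans_lt measure_ball_lt_top, Nat.one_div_pos_of_nat,
    by positivity, fun x hx => ?_, ?_⟩
  · exact (mem_ball_zero_iff.1 hx.1).le
  · filter_upwards [hV.ae_eq_mk] with x hx hmem
    rw [hx]; exact hmem.2

theorem coeFn_sum_smul {N : ℕ} (c : Fin N → ℂ) (f : Fin N → LTwo d) :
    (∑ i, c i • f i : LTwo d) =ᵐ[volume] fun x => ∑ i, c i * f i x := by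
  classical
  induction (Finset.univ : Finset (Fin N)) using Finset.induction_on with
  | empty =>
    simp only [Finset.sum_empty]
    exact Lp.coeFn_zero ℂ 2 volume
  | insert j s hj ih =>
    rw [Finset.sum_insert hj]
    filter_upwards [ih, Lp.coeFn_add (c j • f j) (∑ i ∈ s, c i • f i),
      Lp.coeFn_smul (c j) (f j)] with x h1 h2 h3
    rw [h2, Pi.add_apply, h1, h3, Finset.sum_insert hj, Pi.smul_apply, smul_eq_mul]

theorem norm_sq_sum_le {N : ℕ} (c z : Fin N → ℂ) :
    ‖∑ i, c i * z i‖ ^ 2 ≤ N * ‖c‖ ^ 2 * ∑ i, ‖z i‖ ^ 2 := by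
  have h1 : ‖∑ i, c i * z i‖ ≤ ‖c‖ * ∑ i, ‖z i‖ := by
    rw [Finset.mul_sum]
    refine (norm_sum_le _ _).trans (Finset.sum_le_sum fun i _ => ?_)
    rw [norm_mul]
    exact mul_le_mul_of_nonneg_right (norm_le_pi_norm c i) (norm_nonneg _)
  have h2 : (∑ i, ‖z i‖) ^ 2 ≤ N * ∑ i, ‖z i‖ ^ 2 := by
    simpa using sq_sum_le_card_mul_sum_sq (s := Finset.univ) (f := fun i => ‖z i‖)
  calc _ ≤ (‖c‖ * ∑ i, ‖z i‖) ^ 2 := by gcongr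
    _ = ‖c‖ ^ 2 * (∑ i, ‖z i‖) ^ 2 := by ring
    _ ≤ ‖c‖ ^ 2 * (N * ∑ i, ‖z i‖ ^ 2) := by gcongr
    _ = _ := by ring

theorem sum_smul_mem_formDomain (hT : Measurable T) (hT0 : ∀ η, 0 ≤ T η) {N : ℕ}
    (c : Fin N → ℂ) {f : Fin N → LTwo d} (hf : ∀ i, f i ∈ formDomain T) :
    ∑ i, c i • f i ∈ formDomain T := by
  choose φ hφ using fun i => exists_resRoot_eq hT hT0 (hf i)
  simp only [← hφ, ← map_smul, ← map_sum]
  exact resRoot_mem_formDomain hT hT0 _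

/-- On a bounded set E where V ≤ -a, combinations of plane waves have mass at least κ‖c‖². Replacing
plane waves by trial functions costs O(ε)‖c‖², so the energy is at most (Dε - aκ/2)‖c‖² < 0. -/
theorem exists_negative_family (hT : Measurable T) (hT0 : ∀ η, 0 ≤ T η)
    (hV : AEMeasurable V volume) (hTV : IsRelFormCompact T V) (hV0 : ¬ V =ᵐ[volume] 0)
    (hneg : ∀ᵐ x ∂volume, V x ≤ 0) (hinf : {ξ | IsCritical T ξ}.Infinite) (N : ℕ) :
    ∃ f : Fin N → LTwo d, (∀ i, f i ∈ formDomain T) ∧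
      ∀ c : Fin N → ℂ, c ≠ 0 → (energyForm T V (∑ i, c i • f i) (∑ i, c i • f i)).re < 0 := by
  obtain ⟨E, a, ρ, hEm, hE0, hEt, ha, hρ, hEρ, hEV⟩ := exists_set_potential_le hV hV0 hneg
  let emb := hinf.natEmbedding
  set ξ : Fin N → Eucl d := fun i => emb i with hξdef
  have hξ : Function.Injective ξ := fun i j h => Fin.ext (emb.injective (Subtype.ext h))
  have hξc : ∀ i, IsCritical T (ξ i) := fun i => (emb i).2
  obtain ⟨κ, hκ, hκc⟩ := exists_integral_norm_sum_planeWave_ge hξ hEm hE0 hEt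
  set m := volume.real E with hm
  have hm0 : 0 ≤ m := measureReal_nonneg
  -- D collects both errors: N² from the kinetic energy and the rest from the distance to plane
  -- waves on E. The latter is of order ε², which ε ≤ 1 reduces to ε.
  set D : ℝ := (N : ℝ) ^ 2 + a * (N : ℝ) ^ 2 * ρ ^ 2 * m with hD
  have hD0 : 0 ≤ D := by positivity
  set ε : ℝ := min 1 (a * κ / (4 * (D + 1))) with hε
  have hε0 : 0 < ε := lt_min one_pos (by positivity)
  have hε1 : ε ≤ 1 := min_le_left _ _
  have hεD : ε * D < a * κ / 2 := by
    have h1 : ε ≤ a * κ / (4 * (D + 1)) := min_le_right _ _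
    rw [le_div_iff₀ (by positivity)] at h1
    have h2 : 0 < a * κ := by positivity
    nlinarith
  choose f hfD hfk hfx using fun i => exists_trial hT hT0 (hξc i) hε0
  refine ⟨f, hfD, fun c hc => ?_⟩
  have hn : 0 < ‖c‖ := norm_pos_iff.2 hc
  set F := ∑ i, c i • f i with hF
  have hFD : F ∈ formDomain T := sum_smul_mem_formDomain hT hT0 c hfD
  rw [re_energyForm_self]
  have hkin : (∫ η, T ((2 * Real.pi) • η) * ‖(𝓕 F : LTwo d) η‖ ^ 2) ≤ (N : ℝ) ^ 2 * ε * ‖c‖ ^ 2 := by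
    have hFF : (𝓕 F : LTwo d) = ∑ i, c i • (𝓕 (f i) : LTwo d) := by
      change Lp.fourierTransformₗᵢ (Eucl d) ℂ F = ∑ i, c i • Lp.fourierTransformₗᵢ (Eucl d) ℂ (f i)
      rw [hF, map_sum]; simp only [map_smul]
    calc _ ≤ ∫ η, N * ‖c‖ ^ 2 * ∑ i, T ((2 * Real.pi) • η) * ‖(𝓕 (f i) : LTwo d) η‖ ^ 2 := by
          refine integral_mono_ae hFD ((integrable_finsetSum _ fun i _ => hfD i).const_mul _) ?_
          filter_upwards [coeFn_sum_smul c fun i => (𝓕 (f i) : LTwo d)] with η hη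
          rw [hFF, hη, ← Finset.mul_sum]
          calc _ ≤ T ((2 * Real.pi) • η) * (N * ‖c‖ ^ 2 * ∑ i, ‖(𝓕 (f i) : LTwo d) η‖ ^ 2) :=
                mul_le_mul_of_nonneg_left (norm_sq_sum_le _ _) (hT0 _)
            _ = _ := by ring
      _ = N * ‖c‖ ^ 2 * ∑ i, ∫ η, T ((2 * Real.pi) • η) * ‖(𝓕 (f i) : LTwo d) η‖ ^ 2 := by
          rw [integral_const_mul, integral_finsetSum _ fun i _ => hfD i]
      _ ≤ N * ‖c‖ ^ 2 * ∑ _i : Fin N, ε := by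
          gcongr with i
          exact hfk i
      _ = _ := by simp; ring
  have hVF : Integrable (fun x => V x * ‖F x‖ ^ 2) volume := by
    refine ((integrable_potential hT hT0 hV hTV hFD hFD).re).congr (.of_forall fun x => ?_)
    simp only
    rw [mul_comm (conj _), Complex.mul_conj, Complex.normSq_eq_norm_sq, ← Complex.ofReal_mul]
    rfl
  have hF2 : Integrable (fun x => ‖F x‖ ^ 2) volume :=
    (Lp.memLp F).integrable_norm_pow (by norm_num)
  set P : Eucl d → ℂ := fun x => ∑ i, c i * planeWave (ξ i) x with hP
  have hPc : Continuous P := continuous_finsetSum _ fun i _ =>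
    continuous_const.mul (continuous_planeWave_right (ξ i))
  -- From |P|² ≤ 2|F|² + 2|F - P|².
  have hpt : ∀ᵐ x, x ∈ E → ‖P x‖ ^ 2 / 2 - (N : ℝ) ^ 2 * ‖c‖ ^ 2 * ε ^ 2 * ρ ^ 2 ≤ ‖F x‖ ^ 2 := by
    filter_upwards [coeFn_sum_smul c f, ae_all_iff.2 hfx] with x hx hfx hxE
    have h1 : ‖F x - P x‖ ≤ N * ‖c‖ * ε * ρ := by
      rw [hF, hx, hP]
      simp only
      rw [← Finset.sum_sub_distrib]
      refine (norm_sum_le _ _).trans ?_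
      calc _ ≤ ∑ _i : Fin N, ‖c‖ * (ε * ρ) := by
            refine Finset.sum_le_sum fun i _ => ?_
            rw [← mul_sub, norm_mul]
            refine mul_le_mul (norm_le_pi_norm c i) ((hfx i).2.trans ?_) (norm_nonneg _)
              (norm_nonneg _)
            exact mul_le_mul_of_nonneg_left (hEρ x hxE) hε0.le
        _ = _ := by simp; ring
    have h2 : ‖P x‖ ≤ ‖F x‖ + ‖F x - P x‖ := by
      have : P x = F x - (F x - P x) := by ring
      calc ‖P x‖ = ‖F x - (F x - P x)‖ := by rw [← this]
        _ ≤ _ := norm_sub_le _ _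
    have h3 : ‖F x - P x‖ ^ 2 ≤ (N * ‖c‖ * ε * ρ) ^ 2 := by gcongr
    have h4 : ‖P x‖ ^ 2 ≤ (‖F x‖ + ‖F x - P x‖) ^ 2 := by gcongr
    nlinarith [sq_nonneg (‖F x‖ - ‖F x - P x‖)]
  have hpot : ∫ x, V x * ‖F x‖ ^ 2 ≤
      -a * (κ / 2 * ‖c‖ ^ 2 - (N : ℝ) ^ 2 * ‖c‖ ^ 2 * ε ^ 2 * ρ ^ 2 * m) := by
    have hPi : IntegrableOn (fun x => ‖P x‖ ^ 2) E volume := by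
      refine Measure.integrableOn_of_bounded (M := (∑ i, ‖c i‖) ^ 2) hEt.ne
        (hPc.norm.pow 2).aestronglyMeasurable (.of_forall fun x => ?_)
      rw [norm_pow, norm_norm]
      gcongr
      refine (norm_sum_le _ _).trans (Finset.sum_le_sum fun i _ => ?_)
      rw [norm_mul, norm_planeWave, mul_one]
    have h1 : ∫ x, V x * ‖F x‖ ^ 2 ≤ ∫ x in E, V x * ‖F x‖ ^ 2 := by
      rw [← integral_indicator hEm]
      refine integral_mono_ae hVF (hVF.indicator hEm) ?_
      filter_upwards [hneg] with x hx
      by_cases hxE : x ∈ E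
      · rw [Set.indicator_of_mem hxE]
      · rw [Set.indicator_of_notMem hxE]
        exact mul_nonpos_of_nonpos_of_nonneg hx (sq_nonneg _)
    have h2 : ∫ x in E, V x * ‖F x‖ ^ 2 ≤
        ∫ x in E, -a * (‖P x‖ ^ 2 / 2 - (N : ℝ) ^ 2 * ‖c‖ ^ 2 * ε ^ 2 * ρ ^ 2) := by
      refine setIntegral_mono_on_ae hVF.integrableOn
        (((hPi.div_const 2).sub (integrableOn_const hEt.ne)).const_mul _) hEm ?_
      filter_upwards [hpt, hEV] with x hx hxV hxE
      have := hx hxE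
      have h3 := mul_le_mul_of_nonneg_right (hxV hxE) (sq_nonneg ‖F x‖)
      have h4 := mul_le_mul_of_nonneg_left this ha.le
      linarith
    refine (h1.trans h2).trans ?_
    rw [integral_const_mul, integral_sub (hPi.div_const 2) (integrableOn_const hEt.ne),
      integral_div, setIntegral_const, smul_eq_mul, ← hm]
    have := hκc c
    nlinarith
  have hsum : (N : ℝ) ^ 2 * ε * ‖c‖ ^ 2 +
      -a * (κ / 2 * ‖c‖ ^ 2 - (N : ℝ) ^ 2 * ‖c‖ ^ 2 * ε ^ 2 * ρ ^ 2 * m) =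
      ((N : ℝ) ^ 2 * ε + a * (N : ℝ) ^ 2 * ρ ^ 2 * m * ε ^ 2 - a * κ / 2) * ‖c‖ ^ 2 := by ring
  have hlt : (N : ℝ) ^ 2 * ε + a * (N : ℝ) ^ 2 * ρ ^ 2 * m * ε ^ 2 - a * κ / 2 < 0 := by
    have h1 : a * (N : ℝ) ^ 2 * ρ ^ 2 * m * ε ^ 2 ≤ a * (N : ℝ) ^ 2 * ρ ^ 2 * m * ε := by
      gcongr
      exact pow_le_of_le_one hε0.le hε1 two_ne_zero
    have h2 : ε * D = (N : ℝ) ^ 2 * ε + a * (N : ℝ) ^ 2 * ρ ^ 2 * m * ε := by rw [hD]; ring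
    linarith
  have := mul_neg_of_neg_of_pos hlt (show 0 < ‖c‖ ^ 2 by positivity)
  linarith

end ManyEigenvalues

/-! ### Non-integrability of 1/T near the submanifold. -/

section Submanifold

open Filter Topology
open scoped NNReal ENNReal

variable {d : ℕ}

/-- Lebesgue measure is a multiple of d-dimensional Hausdorff measure, for which the Lipschitz bound
is immediate. -/
theorem volume_image_le_of_lipschitzOnWith {f : Eucl d → Eucl d} {K : ℝ≥0} {s : Set (Eucl d)}
    (h : LipschitzOnWith K f s) : volume (f '' s) ≤ (K : ℝ≥0∞) ^ d * volume s := by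
  have h1 := h.hausdorffMeasure_image_le (d := d) (by positivity)
  rw [← EuclideanSpace.euclideanHausdorffMeasure_eq_volume,
    Measure.euclideanHausdorffMeasure_def, Measure.smul_apply, Measure.smul_apply,
    ENNReal.smul_def, ENNReal.smul_def, smul_eq_mul, smul_eq_mul, mul_left_comm]
  gcongr
  simpa using h1

/-- Were the integral finite, the sublevel sets would have measure tending to 0, and by absolute
continuity so would the integral over them. But that integral is at least cs^n/(Ms^n) = c/M. -/
theorem lintegral_inv_eq_top {S : Eucl d → ℝ} {B : Set (Eucl d)} (hS : Measurable S) {c M s₀ : ℝ}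
    {n : ℕ} (hn : 1 ≤ n) (hc : 0 < c) (hM : 0 < M) (hs₀ : 0 < s₀)
    (h : ∀ s, 0 < s → s < s₀ → ENNReal.ofReal (c * s ^ n) ≤ volume ({ξ | S ξ ≤ M * s ^ n} ∩ B)) :
    ∫⁻ ξ in B, (ENNReal.ofReal (S ξ))⁻¹ = ⊤ := by
  by_contra hI
  set f : Eucl d → ℝ≥0∞ := fun ξ => (ENNReal.ofReal (S ξ))⁻¹ with hf
  set U : ℝ → Set (Eucl d) := fun s => {ξ | S ξ ≤ M * s ^ n} with hU
  have hUm : ∀ s, MeasurableSet (U s) := fun s => measurableSet_le hS measurable_const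
  have hlow : ∀ s, (ENNReal.ofReal (M * s ^ n))⁻¹ * volume (U s ∩ B) ≤
      ∫⁻ ξ in U s, f ξ ∂(volume.restrict B) := by
    intro s
    rw [← Measure.restrict_apply (hUm s), ← setLIntegral_const]
    refine setLIntegral_mono' (hUm s) fun ξ hξ => ?_
    exact ENNReal.inv_le_inv.2 (ENNReal.ofReal_le_ofReal hξ)
  have hnear : ∀ᶠ s : ℝ in 𝓝[>] 0, 0 < s ∧ s < s₀ :=
    (eventually_mem_nhdsWithin).and (nhdsWithin_le_nhds (gt_mem_nhds hs₀))
  have hzero : Tendsto (fun s => (volume.restrict B) (U s)) (𝓝[>] 0) (𝓝 0) := by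
    have hb : Tendsto (fun s : ℝ => ENNReal.ofReal (M * s ^ n) * ∫⁻ ξ in B, f ξ) (𝓝[>] 0)
        (𝓝 0) := by
      have h1 : Tendsto (fun s : ℝ => ENNReal.ofReal (M * s ^ n)) (𝓝[>] 0) (𝓝 0) := by
        have : Continuous fun s : ℝ => ENNReal.ofReal (M * s ^ n) :=
          ENNReal.continuous_ofReal.comp (by fun_prop)
        have h2 := (this.tendsto 0).mono_left (nhdsWithin_le_nhds (s := Set.Ioi 0))
        simpa [zero_pow (by omega : n ≠ 0)] using h2
      simpa using ENNReal.Tendsto.mul_const h1 (Or.inr hI)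
    refine tendsto_of_tendsto_of_tendsto_of_le_of_le' tendsto_const_nhds hb
      (.of_forall fun _ => bot_le) ?_
    filter_upwards [hnear] with s hs
    rw [Measure.restrict_apply (hUm s)]
    have h1 := (hlow s).trans (setLIntegral_le_lintegral _ _)
    have hpos : 0 < M * s ^ n := mul_pos hM (pow_pos hs.1 n)
    rwa [ENNReal.inv_mul_le_iff (by simpa using hpos) ENNReal.ofReal_ne_top] at h1
  have hlim := tendsto_setLIntegral_zero hI hzero
  have hge : ENNReal.ofReal (c / M) ≤ 0 := by
    refine ge_of_tendsto hlim ?_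
    filter_upwards [hnear] with s hs
    refine le_trans ?_ (hlow s)
    have hp : 0 < s ^ n := pow_pos hs.1 n
    have hpos : 0 < M * s ^ n := mul_pos hM hp
    calc ENNReal.ofReal (c / M) = (ENNReal.ofReal (M * s ^ n))⁻¹ * ENNReal.ofReal (c * s ^ n) := by
          rw [← ENNReal.ofReal_inv_of_pos hpos, ← ENNReal.ofReal_mul (by positivity)]
          congr 1
          field_simp
      _ ≤ _ := by gcongr; exact h s hs.1 hs.2
  have : 0 < c / M := by positivity
  simp only [nonpos_iff_eq_zero, ENNReal.ofReal_eq_zero] at hge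
  linarith

/-- The box around `b` with half side `s` in the first `n` directions and `a` in the others. -/
def coordBox (n : ℕ) (b : Eucl d) (s a : ℝ) : Set (Eucl d) :=
  {y | ∀ i : Fin d, |y i - b i| ≤ if (i : ℕ) < n then s else a}

theorem volume_coordBox {n : ℕ} (hn : n ≤ d) (b : Eucl d) {s a : ℝ} (hs : 0 ≤ s) (ha : 0 ≤ a) :
    volume (coordBox n b s a) = ENNReal.ofReal ((2 * a) ^ (d - n) * 2 ^ n * s ^ n) := by
  have h1 : coordBox n b s a = (WithLp.ofLp (p := 2) (V := Fin d → ℝ)) ⁻¹'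
      Set.Icc (fun i => b i - if (i : ℕ) < n then s else a)
        (fun i => b i + if (i : ℕ) < n then s else a) := by
    ext y
    simp only [coordBox, Set.mem_ofPred_eq, Set.mem_preimage, Set.mem_Icc, Pi.le_def, abs_le]
    constructor
    · intro h
      exact ⟨fun i => by linarith [(h i).1], fun i => by linarith [(h i).2]⟩
    · intro h i
      exact ⟨by linarith [h.1 i], by linarith [h.2 i]⟩
  rw [h1, (PiLp.volume_preserving_ofLp (Fin d)).measure_preimage
    measurableSet_Icc.nullMeasurableSet, Real.volume_Icc_pi]
  rw [← ENNReal.ofReal_prod_of_nonneg (fun i _ => by split_ifs <;> linarith)]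
  congr 1
  have h2 : ∀ i : Fin d, (b i + if (i : ℕ) < n then s else a) - (b i - if (i : ℕ) < n then s else a)
      = if (i : ℕ) < n then 2 * s else 2 * a := by
    intro i; split_ifs <;> ring
  simp only [h2]
  rw [Finset.prod_ite, Finset.prod_const, Finset.prod_const, Fin.card_filter_val_lt,
    Finset.filter_not, Finset.card_sdiff_of_subset (Finset.filter_subset _ _),
    Fin.card_filter_val_lt, Finset.card_univ, Fintype.card_fin, min_eq_right hn]
  ring

theorem norm_le_sqrt_mul {v : Eucl d} {a : ℝ} (ha : 0 ≤ a) (h : ∀ i, |v i| ≤ a) :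
    ‖v‖ ≤ √d * a := by
  rw [EuclideanSpace.norm_eq]
  refine Real.sqrt_le_iff.2 ⟨by positivity, ?_⟩
  rw [mul_pow, Real.sq_sqrt (by positivity)]
  calc ∑ i, ‖v i‖ ^ 2 ≤ ∑ _i : Fin d, a ^ 2 :=
        Finset.sum_le_sum fun i _ => pow_le_pow_left₀ (norm_nonneg _) (h i) 2
    _ = _ := by simp

/-- The projection which annihilates the first `n` coordinates. -/
noncomputable def dropCoords (n : ℕ) (y : Eucl d) : Eucl d :=
  WithLp.toLp 2 fun i : Fin d => if (i : ℕ) < n then 0 else y i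

theorem dropCoords_apply (n : ℕ) (y : Eucl d) (i : Fin d) :
    dropCoords n y i = if (i : ℕ) < n then 0 else y i := rfl

theorem dist_dropCoords_le {n : ℕ} {b y : Eucl d} (hb : ∀ i : Fin d, (i : ℕ) < n → b i = 0) :
    dist (dropCoords n y) b ≤ dist y b := by
  rw [EuclideanSpace.dist_eq, EuclideanSpace.dist_eq]
  refine Real.sqrt_le_sqrt (Finset.sum_le_sum fun i _ => ?_)
  rw [dropCoords_apply]
  split_ifs with hi
  · rw [hb i hi, dist_self, zero_pow two_ne_zero]; positivity
  · exact le_rfl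

/-- In a chart, a box of half side s in the n normal directions has volume of order s^n. Its points
correspond to points within O(s) of Σ, where T = O(s^γ) = O(s^n). The chart is Lipschitz near the
point, so the preimage of the box is not much smaller; no Jacobian is needed. -/
theorem IsC2Submanifold.volume_sublevel_ge {n : ℕ} (hnd : n ≤ d)
    {T : Eucl d → ℝ} {S : Set (Eucl d)} (hS : IsC2Submanifold d n S) {O : Set (Eucl d)}
    (hO : IsOpen O) (hSO : S ⊆ O) {C γ : ℝ} (hγ : (n : ℝ) ≤ γ)
    (hTS : ∀ η ∈ O, T η ≤ C * Metric.infDist η S ^ γ) {ξ₀ : Eucl d}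
    (hξ₀ : (2 * Real.pi) • ξ₀ ∈ S) {r : ℝ} (hr : 0 < r) :
    ∃ c M s₀ : ℝ, 0 < c ∧ 0 < M ∧ 0 < s₀ ∧ ∀ s, 0 < s → s < s₀ → ENNReal.ofReal (c * s ^ n) ≤
      volume ({ξ | T ((2 * Real.pi) • ξ) ≤ M * s ^ n} ∩ Metric.ball ξ₀ r) := by
  have hpi := Real.pi_pos
  have h2pi : (2 * Real.pi) ≠ 0 := by positivity
  obtain ⟨e, hω, he, hes, heS⟩ := hS _ hξ₀
  set ω := (2 * Real.pi) • ξ₀ with hωdef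
  set y₀ := e ω with hy₀
  have hy₀t : y₀ ∈ e.target := e.map_source hω
  have hy₀0 : ∀ i : Fin d, (i : ℕ) < n → y₀ i = 0 := (heS ω hω).1 hξ₀
  have hsy : e.symm y₀ = ω := e.left_inv hω
  obtain ⟨K, t, ht, hK⟩ := ((he.contDiffAt (e.open_source.mem_nhds hω)).of_le
    (by norm_num : (1 : WithTop ℕ∞) ≤ 2)).exists_lipschitzOnWith
  obtain ⟨L, t', ht', hL⟩ := ((hes.contDiffAt (e.open_target.mem_nhds hy₀t)).of_le
    (by norm_num : (1 : WithTop ℕ∞) ≤ 2)).exists_lipschitzOnWith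
  have hcont : ContinuousAt e.symm y₀ := e.continuousAt_symm hy₀t
  have hnear : ∀ᶠ y in 𝓝 y₀, y ∈ e.target ∧ y ∈ t' ∧ e.symm y ∈ t ∧ e.symm y ∈ O ∧
      e.symm y ∈ Metric.ball ω (2 * Real.pi * r) := by
    refine Filter.Eventually.and (e.open_target.mem_nhds hy₀t) (Filter.Eventually.and ht' ?_)
    refine (hcont.eventually (by rwa [hsy])).and ((hcont.eventually ?_).and (hcont.eventually ?_))
    · rw [hsy]; exact hO.mem_nhds (hSO hξ₀)
    · rw [hsy]; exact Metric.ball_mem_nhds _ (by positivity)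
  obtain ⟨ρ, hρ, hball⟩ := Metric.eventually_nhds_iff_ball.1 hnear
  set a : ℝ := ρ / (2 * (√d + 1)) with ha
  have ha0 : 0 < a := by positivity
  have hda : √d * a < ρ := by
    have h1 : (√d + 1) * a = ρ / 2 := by rw [ha]; field_simp
    nlinarith
  set q : ℝ := L * √d with hq
  have hq0 : 0 ≤ q := by positivity
  -- The added 1 makes C₁ positive whatever the sign of C; likewise for q + 1 and k below. The bound
  -- (q + 1)s ≤ 1 is what allows the exponent γ to be lowered to n.
  set C₁ : ℝ := |C| + 1 with hC₁
  have hC₁0 : 0 < C₁ := by positivity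
  set k : ℝ := 2 * Real.pi * K + 1 with hk
  have hk0 : 0 < k := by positivity
  refine ⟨(2 * a) ^ (d - n) * 2 ^ n / k ^ d, C₁ * (q + 1) ^ n, min a (1 / (q + 1)),
    by positivity, by positivity, lt_min ha0 (by positivity), fun s hs hs₀ => ?_⟩
  have hsa : s < a := hs₀.trans_le (min_le_left _ _)
  have hsq : (q + 1) * s ≤ 1 := by
    have := hs₀.trans_le (min_le_right _ _)
    rw [lt_div_iff₀ (by positivity)] at this
    linarith
  set A := coordBox n y₀ s a with hA
  set B := {ξ | T ((2 * Real.pi) • ξ) ≤ C₁ * (q + 1) ^ n * s ^ n} ∩ Metric.ball ξ₀ r with hB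
  have hAball : A ⊆ Metric.ball y₀ ρ := by
    intro y hy
    rw [mem_ball_iff_norm]
    refine lt_of_le_of_lt (norm_le_sqrt_mul ha0.le fun i => ?_) hda
    refine (hy i).trans ?_
    split_ifs
    · exact hsa.le
    · exact le_rfl
  have hTle : ∀ y ∈ A, T (e.symm y) ≤ C₁ * (q + 1) ^ n * s ^ n := by
    intro y hy
    have hyb := hAball hy
    obtain ⟨-, hy1, -, hy3, -⟩ := hball y hyb
    -- Zeroing the normal coordinates stays in the ball because y₀ has none, and it yields a nearby
    -- point of Σ.
    have hzb : dropCoords n y ∈ Metric.ball y₀ ρ :=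
      lt_of_le_of_lt (dist_dropCoords_le hy₀0) hyb
    obtain ⟨hz0, hz1, -, -, -⟩ := hball _ hzb
    have hzS : e.symm (dropCoords n y) ∈ S := by
      rw [heS _ (e.map_target hz0), e.right_inv hz0]
      intro i hi
      rw [dropCoords_apply, if_pos hi]
    have hdist : Metric.infDist (e.symm y) S ≤ (q + 1) * s := by
      refine (Metric.infDist_le_dist_of_mem hzS).trans ((hL.dist_le_mul _ hy1 _ hz1).trans ?_)
      have h1 : dist y (dropCoords n y) ≤ √d * s := by
        rw [dist_eq_norm]
        refine norm_le_sqrt_mul hs.le fun i => ?_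
        rw [PiLp.sub_apply, dropCoords_apply]
        split_ifs with hi
        · have := hy i
          rw [if_pos hi, hy₀0 i hi] at this
          exact this
        · simpa using hs.le
      calc (L : ℝ) * dist y (dropCoords n y) ≤ L * (√d * s) := by gcongr
        _ = q * s := by rw [hq]; ring
        _ ≤ (q + 1) * s := by nlinarith
    have hD0 : 0 ≤ Metric.infDist (e.symm y) S := Metric.infDist_nonneg
    have hpow : Metric.infDist (e.symm y) S ^ γ ≤ ((q + 1) * s) ^ n := by
      calc _ ≤ ((q + 1) * s) ^ γ :=
            Real.rpow_le_rpow hD0 hdist ((Nat.cast_nonneg n).trans hγ)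
        _ ≤ ((q + 1) * s) ^ (n : ℝ) :=
            Real.rpow_le_rpow_of_exponent_ge (by positivity) hsq hγ
        _ = _ := Real.rpow_natCast _ _
    calc T (e.symm y) ≤ C * Metric.infDist (e.symm y) S ^ γ := hTS _ hy3
      _ ≤ C₁ * Metric.infDist (e.symm y) S ^ γ := by
        refine mul_le_mul_of_nonneg_right ?_ (Real.rpow_nonneg hD0 _)
        rw [hC₁]; linarith [le_abs_self C]
      _ ≤ C₁ * ((q + 1) * s) ^ n := by gcongr
      _ = _ := by rw [mul_pow]; ring
  set D := B ∩ {ξ | (2 * Real.pi) • ξ ∈ t} with hDdef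
  have hlip : LipschitzOnWith k.toNNReal (fun ξ => e ((2 * Real.pi) • ξ)) D := by
    refine LipschitzOnWith.of_dist_le_mul fun x hx z hz => ?_
    refine (hK.dist_le_mul _ hx.2 _ hz.2).trans ?_
    rw [dist_smul₀, Real.norm_of_nonneg (by positivity)]
    rw [Real.coe_toNNReal _ hk0.le]
    have : 0 ≤ dist x z := dist_nonneg
    rw [hk]; nlinarith
  have hAD : A ⊆ (fun ξ => e ((2 * Real.pi) • ξ)) '' D := by
    intro y hy
    obtain ⟨hy0, -, hy2, -, hy4⟩ := hball y (hAball hy)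
    have hsm : (2 * Real.pi) • ((2 * Real.pi)⁻¹ • e.symm y) = e.symm y := smul_inv_smul₀ h2pi _
    refine ⟨(2 * Real.pi)⁻¹ • e.symm y, ⟨⟨?_, ?_⟩, ?_⟩, ?_⟩
    · rw [Set.mem_ofPred_eq, hsm]; exact hTle y hy
    · rw [Metric.mem_ball] at hy4 ⊢
      have h1 : dist (e.symm y) ω = 2 * Real.pi * dist ((2 * Real.pi)⁻¹ • e.symm y) ξ₀ := by
        conv_lhs => rw [← hsm, hωdef, dist_smul₀, Real.norm_of_nonneg (by positivity)]
      rw [h1] at hy4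
      exact lt_of_mul_lt_mul_left hy4 (by positivity)
    · rw [Set.mem_ofPred_eq, hsm]; exact hy2
    · simp only [hsm, e.right_inv hy0]
  have hvol : ENNReal.ofReal ((2 * a) ^ (d - n) * 2 ^ n * s ^ n) ≤
      ENNReal.ofReal k ^ d * volume B := by
    rw [← volume_coordBox hnd y₀ hs.le ha0.le]
    refine (measure_mono hAD).trans ((volume_image_le_of_lipschitzOnWith hlip).trans ?_)
    change ENNReal.ofReal k ^ d * volume D ≤ _
    gcongr
    exact Set.inter_subset_left
  have hk' : ENNReal.ofReal k ^ d = ENNReal.ofReal (k ^ d) := (ENNReal.ofReal_pow hk0.le d).symm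
  rw [hk'] at hvol
  have h3 : ENNReal.ofReal ((2 * a) ^ (d - n) * 2 ^ n / k ^ d * s ^ n) =
      (ENNReal.ofReal (k ^ d))⁻¹ * ENNReal.ofReal ((2 * a) ^ (d - n) * 2 ^ n * s ^ n) := by
    rw [← ENNReal.ofReal_inv_of_pos (by positivity), ← ENNReal.ofReal_mul (by positivity)]
    congr 1
    field_simp
  rw [h3, ENNReal.inv_mul_le_iff (by simp; positivity) ENNReal.ofReal_ne_top]
  exact hvol

/-- As n < d, the coordinate with zero-based index n is tangential, and moving along it in a chart
stays in the submanifold. -/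
theorem IsC2Submanifold.infinite {n : ℕ} (hnd : n < d) {S : Set (Eucl d)}
    (hS : IsC2Submanifold d n S) (hne : S.Nonempty) : S.Infinite := by
  obtain ⟨ω, hω⟩ := hne
  obtain ⟨e, hωe, -, -, heS⟩ := hS ω hω
  have h0 : ∀ i : Fin d, (i : ℕ) < n → e ω i = 0 := (heS ω hωe).1 hω
  obtain ⟨ρ, hρ, hball⟩ := Metric.isOpen_iff.1 e.open_target _ (e.map_source hωe)
  let v : Eucl d := EuclideanSpace.single (⟨n, hnd⟩ : Fin d) (1 : ℝ)
  have hv1 : ‖v‖ = 1 := by simp [v]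
  have hmem : ∀ s ∈ Set.Ioo 0 ρ, e ω + s • v ∈ e.target := by
    intro s hs
    refine hball ?_
    rw [mem_ball_iff_norm, add_sub_cancel_left, norm_smul, hv1, mul_one,
      Real.norm_of_nonneg hs.1.le]
    exact hs.2
  refine Set.infinite_of_injOn_mapsTo (s := Set.Ioo 0 ρ) (f := fun s => e.symm (e ω + s • v))
    ?_ ?_ (Set.Ioo_infinite hρ)
  · intro s hs s' hs' h
    have h1 := e.symm.injOn (hmem s hs) (hmem s' hs') h
    have h2 := add_left_cancel h1
    have h3 : v ≠ 0 := by rw [← norm_ne_zero_iff, hv1]; exact one_ne_zero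
    exact smul_left_injective ℝ h3 h2
  · intro s hs
    rw [heS _ (e.map_target (hmem s hs)), e.right_inv (hmem s hs)]
    intro i hi
    have : i ≠ ⟨n, hnd⟩ := by rintro rfl; exact lt_irrefl _ hi
    simp [v, h0 i hi, this]

end Submanifold

/-! ### The two assertions. -/

theorem corollary2p5 (d n : ℕ) (hn : 1 ≤ n) (hnd : n ≤ d - 1)
    (T : Eucl d → ℝ) (hT : Measurable T) (hT0 : ∀ η, 0 ≤ T η)
    (V : Eucl d → ℝ) (hV : AEMeasurable V volume) (hV0 : ¬ V =ᵐ[volume] 0)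
    (hTV : IsRelFormCompact T V)
    (S : Set (Eucl d)) (hSne : S.Nonempty) (hS : IsC2Submanifold d n S)
    (O : Set (Eucl d)) (hO : IsOpen O) (hSO : S ⊆ O)
    (C γ : ℝ) (hγ : (n : ℝ) ≤ γ)
    (hTS : ∀ η ∈ O, T η ≤ C * Metric.infDist η S ^ γ) :
    ((∀ᵐ x ∂volume, V x ≤ 0) →
      {E : ℝ | E < 0 ∧ IsSchrodingerEigenvalue T V E}.Infinite) ∧
    (Integrable V volume → (∫ x, V x) ≤ 0 →
      ∃ E : ℝ, E < 0 ∧ IsSchrodingerEigenvalue T V E) := by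
  have h2pi : (2 * Real.pi) ≠ 0 := by have := Real.pi_pos; positivity
  -- A momentum ω corresponds to the Fourier variable ω/(2π).
  have hcrit : ∀ ω ∈ S, IsCritical T ((2 * Real.pi)⁻¹ • ω) := by
    intro ω hω r hr
    obtain ⟨c, M, s₀, hc, hM, hs₀, h⟩ := hS.volume_sublevel_ge (by omega) hO hSO hγ hTS
      (ξ₀ := (2 * Real.pi)⁻¹ • ω) (by rwa [smul_inv_smul₀ h2pi]) hr
    exact lintegral_inv_eq_top (measurable_scaled hT) hn hc hM hs₀ h
  have hinf : {ξ | IsCritical T ξ}.Infinite :=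
    Set.infinite_of_injOn_mapsTo (smul_right_injective _ (inv_ne_zero h2pi)).injOn hcrit
      (hS.infinite (by omega) hSne)
  refine ⟨fun hneg => infinite_negative_eigenvalues hT hT0 hV hTV
    (exists_negative_family hT hT0 hV hTV hV0 hneg hinf), fun hVi hneg => ?_⟩
  obtain ⟨ω, hω⟩ := hSne
  obtain ⟨f, hf, hfneg⟩ := exists_negative_energy hT hT0 hV hTV hVi hV0 hneg (hcrit ω hω)
  exact exists_negative_eigenvalue hT hT0 hV hTV hf hfneg
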